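/- Let $G$ be a locally compact Hausdorff group and $K<G$ a compact subgroup such that $(G,K)$ is a Gelfand pair, i.e. the bi-$K$-invariant bounded (Radon) measures on $G$ commute under convolution. Let $P<G$ be a closed subgroup with $G=KP$. Let $\nabla_P$ be the modular function of $P$, normalised by $\lambda(Ep)=\nabla_P(p)\,\lambda(E)$ for a left Haar measure $\lambda$ of $P$, and let $dk$ be the Haar probability measure on $K$. Then $\varrho(kp)=\nabla_P(p)$ ($k\in K$, $p\in P$) gives a well-defined continuous function $\varrho\colon G\to\mathbf R_{>0}$. For $s\in\mathbf C$ define $$\varphi_s(g)=\int_K \varrho(g^{-1}k)^{\frac12+is}\,dk .$$ For a continuous character $\chi\colon P\to\mathbf C^*$, let $I(\chi)$ be the space of continuous functions $F\colon G\to\mathbf C$, compactly supported modulo $P$, such that $F(xp)=\big(\nabla_P(p)/\nabla_G(p)\big)^{1/2}\chi(p)F(x)$ for all $x\in G$, $p\in P$, with $G$ acting by left translation $(gF)(x)=F(g^{-1}x)$. If $\chi$ is unitary, the representation unitarily induced from $\chi$ is the unitary representation of $G$ on the Hilbert space completion of $I(\chi)$ for the invariant inner product $\langle F_1,F_2\rangle=\int_G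 \phi\,F_1\overline{F_2}\,dx$, where $dx$ is a left Haar measure of $G$ and $\phi\ge 0$ is any continuous compactly supported function on $G$ with $\int_P\phi(xp)\,dp=1$ for all $x$ with $F_1(x)\overline{F_2(x)}\neq 0$, $dp$ being a left Haar measure of $P$. 1. For every $s\in\mathbf C$, the representation $I(\nabla_P^{is})$ contains a $K$-fixed vector $v$ with $\int_K|v(k)|^2dk=1$, unique up to a scalar of modulus one, and $\varphi_s$ is its matrix coefficient: $\varphi_s(g)=\int_K (gv)(k)\,\overline{v(k)}\,dk$ for all $g\in G$. 2. For every $s\in\mathbf R$, the representation $\pi_s$ of $G$ unitarily induced from the unitary character $\nabla_P^{is}$ of $P$ exists and is a strongly continuous unitary representation. It has a $K$-fixed unit vector $v$, unique up to a scalar of modulus one, and $\varphi_s(g)=\langle\pi_s(g)v,v\rangle$ for all $g\in G$. 3. For every $s\in\mathbf R$, $\varphi_s$ is a pure positive-definite spherical function on $G$. That is: $\varphi_s$ is continuous and nonzero and satisfies $\varphi_s(x)\varphi_s(y)=\int_K\varphi_s(xky)\,dk$ for all $x,y\in G$; it is positive-definite; and whenever $\varphi_s=\psi_1+\psi_2$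 with $\psi_1,\psi_2$ continuous positive-definite functions on $G$, $\psi_1$ and $\psi_2$ are scalar multiples of $\varphi_s$. -/

import Mathlib

open MeasureTheory
open scoped ComplexConjugate ComplexOrder

noncomputable section

namespace GelfandSpherical

/-! ### Gelfand pairs -/

/-- A measure on `G` is bi-`K`-invariant if it is invariant under left and right translation by
every element of `K`. -/
def IsBiInvariant {G : Type*} [Group G] [MeasurableSpace G] (K : Subgroup G) (μ : Measure G) :
    Prop :=
  ∀ k ∈ K, μ.map (fun x => k * x) = μ ∧ μ.map (fun x => x * k) = μ

/-- The integral of `f` against the convolution `μ * ν`, the push-forward of `μ ⊗ ν` under the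
multiplication map. It is written as an iterated integral because for a group that is not second
countable the Borel sets of `G × G` need not lie in the product `σ`-algebra. -/
def convIntegral {G : Type*} [Group G] [MeasurableSpace G] (μ ν : Measure G) (f : G → ℝ) : ℝ :=
  ∫ x, ∫ y, f (x * y) ∂ν ∂μ

/-- `(G, K)` is a Gelfand pair: bounded bi-`K`-invariant (Radon) measures commute under convolution.
A Radon measure is determined by its integrals of compactly supported continuous functions.
A bounded bi-`K`-invariant measure is a linear combination of positive ones (its Jordan
decomposition is again bi-`K`-invariant) and convolution is bilinear, so the algebra of all of them
is commutative exactly when the positive ones commute. -/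
def IsGelfandPair {G : Type*} [Group G] [TopologicalSpace G] [MeasurableSpace G] [BorelSpace G]
    (K : Subgroup G) : Prop :=
  ∀ (μ ν : Measure G) [IsFiniteMeasure μ] [IsFiniteMeasure ν] [μ.Regular] [ν.Regular],
    IsBiInvariant K μ → IsBiInvariant K ν →
    ∀ f : G → ℝ, Continuous f → HasCompactSupport f → convIntegral μ ν f = convIntegral ν μ f

/-- The Haar probability measure of a compact group. -/
def haarProb (K : Type*) [Group K] [TopologicalSpace K] [IsTopologicalGroup K] [CompactSpace K]
    [MeasurableSpace K] [BorelSpace K] : Measure K :=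
  Measure.haarMeasure ⊤

instance haarProb_isProbabilityMeasure (K : Type*) [Group K] [TopologicalSpace K]
    [IsTopologicalGroup K] [CompactSpace K] [MeasurableSpace K] [BorelSpace K] :
    IsProbabilityMeasure (haarProb K) :=
  ⟨by simpa [haarProb] using
    Measure.haarMeasure_self (K₀ := (⊤ : TopologicalSpace.PositiveCompacts K))⟩

/-! ### Modular functions -/

instance closedSubgroup_locallyCompactSpace {G : Type*} [Group G] [TopologicalSpace G]
    [LocallyCompactSpace G] (P : ClosedSubgroup G) : LocallyCompactSpace P.toSubgroup :=
  (show IsClosed (P.toSubgroup : Set G) from P.isClosed').isClosedEmbedding_subtypeVal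
    |>.locallyCompactSpace

/-- The modular function `∇_H` of a locally compact group, normalised by `λ(E h) = ∇_H(h) λ(E)` for a
left Haar measure `λ` (see `map_mul_right_inv`). Mathlib's `modularCharacter` is its inverse. -/
def modularFunction {H : Type*} [Group H] [TopologicalSpace H] [IsTopologicalGroup H]
    [LocallyCompactSpace H] (h : H) : ℝ :=
  ((Measure.modularCharacter h : NNReal) : ℝ)⁻¹

theorem modularFunction_pos {H : Type*} [Group H] [TopologicalSpace H] [IsTopologicalGroup H]
    [LocallyCompactSpace H] (h : H) : 0 < modularFunction h :=
  inv_pos.mpr (NNReal.coe_pos.mpr (Measure.modularCharacterFun_pos h))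

theorem modularFunction_one {H : Type*} [Group H] [TopologicalSpace H] [IsTopologicalGroup H]
    [LocallyCompactSpace H] : modularFunction (1 : H) = 1 := by
  simp [modularFunction]

theorem modularFunction_mul {H : Type*} [Group H] [TopologicalSpace H] [IsTopologicalGroup H]
    [LocallyCompactSpace H] (a b : H) :
    modularFunction (a * b) = modularFunction a * modularFunction b := by
  simp [modularFunction, mul_comm]

theorem modularFunction_inv {H : Type*} [Group H] [TopologicalSpace H] [IsTopologicalGroup H]
    [LocallyCompactSpace H] (a : H) : modularFunction a⁻¹ = (modularFunction a)⁻¹ := by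
  have h := modularFunction_mul a⁻¹ a
  rw [inv_mul_cancel, modularFunction_one] at h
  exact eq_inv_of_mul_eq_one_left h.symm

/-- The preimage of `E` under right multiplication by `h⁻¹` is `E h`. -/
theorem map_mul_right_inv {H : Type*} [Group H] [TopologicalSpace H] [IsTopologicalGroup H]
    [LocallyCompactSpace H] [MeasurableSpace H] [BorelSpace H] (μ : Measure H) [μ.IsHaarMeasure]
    [μ.InnerRegular] (h : H) :
    μ.map (fun x => x * h⁻¹) = ENNReal.ofReal (modularFunction h) • μ := by
  have h1 := Measure.map_right_mul_eq_modularCharacterFun_smul μ h⁻¹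
  have h2 : (Measure.modularCharacterFun h⁻¹ : NNReal) = (modularFunction h).toNNReal := by
    have h3 := modularFunction_inv h⁻¹
    rw [inv_inv] at h3
    rw [h3]
    simp only [modularFunction, inv_inv, Real.toNNReal_coe]
    rfl
  rw [h1, h2]
  rfl

/-- The complex character `∇_P ^ {i s}` of `P`; it is unitary when `s` is real. -/
def modularPower (P : Type*) [Group P] [TopologicalSpace P] [IsTopologicalGroup P]
    [LocallyCompactSpace P] (s : ℂ) : P →* ℂ where
  toFun p := (modularFunction p : ℂ) ^ (Complex.I * s)
  map_one' := by simp [modularFunction_one]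
  map_mul' a b := by
    rw [modularFunction_mul, Complex.ofReal_mul,
      Complex.mul_cpow_ofReal_nonneg (modularFunction_pos a).le (modularFunction_pos b).le]

/-! ### The functions `ϱ` and `φ_s` -/

section Spherical

variable {G : Type*} [Group G] [TopologicalSpace G] [IsTopologicalGroup G]

open Classical in
/-- The function `ϱ(k p) = ∇_P(p)` for `k ∈ K` and `p ∈ P`: the value at `g` is `∇_P(p)` for some
`p ∈ P` with `g p⁻¹ ∈ K` (and `0` outside `K P`). -/
def rho (K P : Subgroup G) [LocallyCompactSpace P] (g : G) : ℝ :=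
  if h : ∃ p : P, g * (p : G)⁻¹ ∈ K then modularFunction h.choose else 0

/-- `φ_s(g) = ∫_K ϱ(g⁻¹ k) ^ (1/2 + i s) dk`. -/
def phi [MeasurableSpace G] [BorelSpace G] (K P : Subgroup G) [CompactSpace K]
    [LocallyCompactSpace P] (s : ℂ) (g : G) : ℂ :=
  ∫ k : K, (rho K P (g⁻¹ * (k : G)) : ℂ) ^ (1 / 2 + Complex.I * s) ∂(haarProb K)

/-- Spherical functions on `(G, K)`: nonzero continuous solutions of
`φ(x) φ(y) = ∫_K φ(x k y) dk`. -/
def IsSpherical [MeasurableSpace G] [BorelSpace G] (K : Subgroup G) [CompactSpace K]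
    (φ : G → ℂ) : Prop :=
  Continuous φ ∧ φ ≠ 0 ∧ ∀ x y : G, φ x * φ y = ∫ k : K, φ (x * (k : G) * y) ∂(haarProb K)

/-- Positive-definite functions on `G`; `0 ≤ z` for a complex number means that `z` is real and
nonnegative. -/
def IsPositiveDefinite (φ : G → ℂ) : Prop :=
  ∀ (n : ℕ) (g : Fin n → G) (c : Fin n → ℂ),
    0 ≤ ∑ i, ∑ j, conj (c i) * c j * φ ((g i)⁻¹ * g j)

/-- A nonzero continuous positive-definite function is pure if it spans an extreme ray of the cone of
continuous positive-definite functions on `G`: in every decomposition `φ = ψ₁ + ψ₂` in this cone,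
`ψ₁` (hence also `ψ₂`) is a multiple of `φ`. -/
def IsPure (φ : G → ℂ) : Prop :=
  φ ≠ 0 ∧ Continuous φ ∧ IsPositiveDefinite φ ∧
    ∀ ψ₁ ψ₂ : G → ℂ, Continuous ψ₁ → IsPositiveDefinite ψ₁ → Continuous ψ₂ →
      IsPositiveDefinite ψ₂ → φ = ψ₁ + ψ₂ → ∃ c : ℝ, ∀ x, ψ₁ x = c * φ x

end Spherical

/-! ### Induced representations -/

section Induction

variable {G : Type*} [Group G] [TopologicalSpace G] [IsTopologicalGroup G]
  [LocallyCompactSpace G]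

/-- The space of the (normalised) induction of a character `χ` from `P` to `G`: continuous functions
`F` on `G`, compactly supported modulo `P`, with
`F(x p) = (∇_P(p) / ∇_G(p)) ^ (1/2) χ(p) F(x)` for `x ∈ G` and `p ∈ P`. -/
def inducedSections (P : Subgroup G) [LocallyCompactSpace P] (χ : P →* ℂ) :
    Submodule ℂ (G → ℂ) where
  carrier := {F | Continuous F ∧
    (∃ C : Set G, IsCompact C ∧ ∀ x, F x ≠ 0 → ∃ c ∈ C, ∃ p : P, x = c * p) ∧
    ∀ (x : G) (p : P), F (x * p) =
      (Real.sqrt (modularFunction p / modularFunction (p : G)) : ℂ) * χ p * F x}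
  zero_mem' := ⟨continuous_const, ⟨∅, isCompact_empty, by simp⟩, by simp⟩
  add_mem' := by
    rintro F₁ F₂ ⟨h₁, ⟨C₁, hC₁, hs₁⟩, he₁⟩ ⟨h₂, ⟨C₂, hC₂, hs₂⟩, he₂⟩
    refine ⟨h₁.add h₂, ⟨C₁ ∪ C₂, hC₁.union hC₂, fun x hx => ?_⟩, fun x p => ?_⟩
    · by_cases h : F₁ x = 0
      · have h' : F₂ x ≠ 0 := fun h0 => hx (by simp [h, h0])
        obtain ⟨c, hc, p, hp⟩ := hs₂ x h'
        exact ⟨c, Or.inr hc, p, hp⟩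
      · obtain ⟨c, hc, p, hp⟩ := hs₁ x h
        exact ⟨c, Or.inl hc, p, hp⟩
    · simp only [Pi.add_apply, he₁, he₂]
      ring
  smul_mem' := by
    rintro a F ⟨h, ⟨C, hC, hs⟩, he⟩
    refine ⟨h.const_smul a, ⟨C, hC, fun x hx => hs x fun h0 => hx (by simp [h0])⟩, fun x p => ?_⟩
    simp only [Pi.smul_apply, smul_eq_mul, he]
    ring

/-- The group `G` acts on induced sections by left translation, `(g F)(x) = F(g⁻¹ x)`. -/
def sectionRep (P : Subgroup G) [LocallyCompactSpace P] (χ : P →* ℂ) :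
    Representation ℂ G (inducedSections P χ) where
  toFun g :=
    { toFun := fun F => ⟨fun x => F.1 (g⁻¹ * x), by
        obtain ⟨F, h, ⟨C, hC, hs⟩, he⟩ := F
        refine ⟨h.comp (continuous_const_mul g⁻¹),
          ⟨(fun x => g * x) '' C, hC.image (continuous_const_mul g), fun x hx => ?_⟩,
          fun x p => ?_⟩
        · obtain ⟨c, hc, p, hp⟩ := hs _ hx
          exact ⟨g * c, ⟨c, hc, rfl⟩, p, by rw [mul_assoc, ← hp, mul_inv_cancel_left]⟩
        · simp only [← mul_assoc, he]⟩
      map_add' := fun _ _ => rfl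
      map_smul' := fun _ _ => rfl }
  map_one' := by
    ext F x
    simp
  map_mul' a b := by
    ext F x
    simp [mul_assoc]

/-- `π`, with the map `J` from induced sections to its Hilbert space, is the representation of `G`
unitarily induced from the unitary character `χ` of `P`: a strongly continuous unitary
representation on the Hilbert space completion of the induced sections (that is, `J` has dense range
and preserves inner products) which extends left translation. The invariant inner product of two
sections is `⟨F₁, F₂⟩ = ∫_G φ conj(F₁) F₂ dx` (conjugate-linear in the first variable) for any
continuous compactly supported `φ ≥ 0` on `G` with `∫_P φ(x p) dp = 1` wherever
`conj(F₁) F₂` does not vanish; here `dx` and `dp` are left Haar measures. -/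
structure IsUnitarilyInduced [MeasurableSpace G] [BorelSpace G]
    (P : Subgroup G) [LocallyCompactSpace P] (χ : P →* ℂ)
    {H : Type*} [NormedAddCommGroup H] [InnerProductSpace ℂ H] [CompleteSpace H]
    (π : G →* unitary (H →L[ℂ] H)) (J : inducedSections P χ →ₗ[ℂ] H) : Prop where
  unitary_char : ∀ p : P, ‖χ p‖ = 1
  strongly_continuous : ∀ v : H, Continuous fun g : G => (π g : H →L[ℂ] H) v
  dense_range : DenseRange J
  equivariant : ∀ (g : G) (F : inducedSections P χ),
    J (sectionRep P χ g F) = (π g : H →L[ℂ] H) (J F)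
  inner_eq : ∀ (F₁ F₂ : inducedSections P χ) (φ : G → ℝ), Continuous φ → HasCompactSupport φ →
    (∀ x, 0 ≤ φ x) →
    (∀ x, conj (F₁.1 x) * F₂.1 x ≠ 0 → ∫ p : P, φ (x * (p : G)) ∂Measure.haar = 1) →
    inner ℂ (J F₁) (J F₂) = ∫ x, (φ x : ℂ) * (conj (F₁.1 x) * F₂.1 x) ∂Measure.haar

/-- The unit vectors of a Hilbert space representation that are fixed by `K`. -/
def IsFixedUnitVector {H : Type*} [NormedAddCommGroup H] [InnerProductSpace ℂ H]
    [CompleteSpace H] (K : Subgroup G) (π : G →* unitary (H →L[ℂ] H)) (v : H) : Prop :=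
  ‖v‖ = 1 ∧ ∀ k ∈ K, (π k : H →L[ℂ] H) v = v

/-- The `K`-fixed induced sections `F` with `∫_K |F(k)|² dk = 1`. -/
def IsFixedUnitSection [MeasurableSpace G] [BorelSpace G] (K P : Subgroup G) [CompactSpace K]
    [LocallyCompactSpace P] (χ : P →* ℂ) (F : inducedSections P χ) : Prop :=
  (∫ k : K, ‖F.1 k‖ ^ 2 ∂(haarProb K)) = 1 ∧ ∀ k ∈ K, sectionRep P χ k F = F

end Induction

end GelfandSpherical

end

universe u v

open GelfandSpherical

/-! Commutativity enters only through unimodularity of `G`. Convolving the uniform measures on `K x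
K` and `K y K` gives `∫_K f(x k y) dk = ∫_K f(y k x) dk` for bi-`K`-invariant `f` in `C_c(G)`;
integrating over `x` yields `∇_G(y) = 1` (`IsGelfandPair.modularFunction_eq_one`).

Sections of `I(∇_P^{is})` then transform under `P` by `∇_P^{1/2+is}`. Since `G = K P`, a `K`-fixed
section is determined by its value at `1`, so it is a multiple of `ϱ^{1/2+is}`. That section is `1`
on `K`, and the formula for `φ_s` is literally its matrix coefficient.

For real `s`, a product `conj(F₁) F₂` transforms by `∇_P`, i.e. it is a density on `G / P`.
Unfolding shows that its integral does not depend on the normalising function and equals a fixed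
positive constant times its integral over `K` (`exists_integral_eq_sectionInner`). So the inner
product of `L²(K)` is `G`-invariant on sections, and completion gives the unitary representation.

In this representation the average of `π(k)` over `K` is the rank-one projection `v ↦ ⟨w, v⟩ w` onto
a unit vector `w` (`exists_spherical_vector`). Everything else follows from this identity:
uniqueness of the fixed vector, the functional equation (`isSpherical_inner`), and purity
(`isPure_inner`), because a positive-definite function dominated by `φ_s` has the form `g ↦ ⟨u, π(g)
w⟩` and is left `K`-invariant. -/

namespace GelfandSpherical

open Topology

/-! ### Haar measures on compact groups -/

section CompactGroup

variable {K : Type*} [Group K] [TopologicalSpace K] [IsTopologicalGroup K] [CompactSpace K]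
  [MeasurableSpace K] [BorelSpace K]

instance haarProb_isHaarMeasure : (haarProb K).IsHaarMeasure :=
  inferInstanceAs (Measure.haarMeasure (⊤ : TopologicalSpace.PositiveCompacts K)).IsHaarMeasure

instance haarProb_isMulRightInvariant : (haarProb K).IsMulRightInvariant where
  map_mul_right_eq_self k := by
    have : IsProbabilityMeasure ((haarProb K).map (· * k)) :=
      Measure.isProbabilityMeasure_map (measurable_mul_const k).aemeasurable
    exact Measure.isHaarMeasure_eq_of_isProbabilityMeasure _ _

instance haarProb_isInvInvariant : (haarProb K).IsInvInvariant where
  inv_eq_self := by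
    have h : IsProbabilityMeasure (haarProb K).inv :=
      Measure.isProbabilityMeasure_map measurable_inv.aemeasurable
    have : (haarProb K).inv.IsHaarMeasure := {}
    exact Measure.isHaarMeasure_eq_of_isProbabilityMeasure _ _

theorem haarProb_map {L : Type*} [Group L] [TopologicalSpace L] [IsTopologicalGroup L]
    [CompactSpace L] [MeasurableSpace L] [BorelSpace L] {f : L →* K} (hf : Continuous f)
    (hs : Function.Surjective f) : (haarProb L).map f = haarProb K :=
  (MonoidHom.measurePreserving hf hs (by simp)).map_eq

theorem integrable_haarProb {E : Type*} [NormedAddCommGroup E] {f : K → E} (hf : Continuous f) :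
    Integrable f (haarProb K) :=
  hf.integrable_of_hasCompactSupport (HasCompactSupport.of_compactSpace f)

/-- Fubini's theorem for a compact group and a compactly supported continuous function. -/
theorem integral_haarProb_swap {X : Type*} [TopologicalSpace X] [MeasurableSpace X]
    [OpensMeasurableSpace X] {E : Type*} [NormedAddCommGroup E] [NormedSpace ℝ E]
    {μ : Measure X} [IsFiniteMeasureOnCompacts μ] {f : X → K → E}
    (hf : Continuous f.uncurry) {C : Set X} (hC : IsCompact C) (hC' : IsClosed C)
    (h : ∀ x k, x ∉ C → f x k = 0) :
    ∫ x, ∫ k, f x k ∂(haarProb K) ∂μ = ∫ k, ∫ x, f x k ∂μ ∂(haarProb K) := by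
  refine integral_integral_swap_of_hasCompactSupport hf
    (HasCompactSupport.intro' (hC.prod isCompact_univ) (hC'.prod isClosed_univ) ?_)
  rintro ⟨x, k⟩ hxk
  exact h x k fun hx => hxk ⟨hx, trivial⟩

/-- Averages over a compact group depend continuously on parameters. -/
theorem continuous_integral_haarProb {X : Type*} [TopologicalSpace X]
    {E : Type*} [NormedAddCommGroup E] [NormedSpace ℝ E] {f : X → K → E}
    (hf : Continuous f.uncurry) : Continuous fun x => ∫ k, f x k ∂(haarProb K) := by
  rw [← continuousOn_univ]
  exact continuousOn_integral_of_compact_support isCompact_univ hf.continuousOn (by simp)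

end CompactGroup

/-! ### Modular functions -/

section Modular

variable {H : Type*} [Group H] [TopologicalSpace H] [IsTopologicalGroup H]
  [LocallyCompactSpace H] [MeasurableSpace H] [BorelSpace H]

theorem integral_mul_right {E : Type*} [NormedAddCommGroup E] [NormedSpace ℝ E] (μ : Measure H)
    [μ.IsHaarMeasure] [μ.Regular] (f : H → E) (h : H) :
    ∫ x, f (x * h) ∂μ = (modularFunction h)⁻¹ • ∫ x, f x ∂μ := by
  have h1 : μ.map (· * h) = Measure.modularCharacterFun h • μ := by
    rw [Measure.modularCharacterFun_eq_haarScalarFactor μ _]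
    have : (μ.map (· * h)).Regular := Measure.Regular.map (Homeomorph.mulRight h)
    exact Measure.isMulLeftInvariant_eq_smul_of_regular _ μ
  have h2 : ∫ x, f (x * h) ∂μ = ∫ x, f x ∂(μ.map (· * h)) :=
    ((measurableEmbedding_mulRight h).integral_map f).symm
  rw [h2, h1, integral_smul_nnreal_measure, modularFunction, inv_inv]
  rfl

theorem exists_integral_pos (μ : Measure H) [μ.IsHaarMeasure] :
    ∃ f : H → ℝ, Continuous f ∧ HasCompactSupport f ∧ 0 ≤ f ∧ f 1 ≠ 0 ∧ 0 < ∫ x, f x ∂μ := by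
  obtain ⟨⟨f, hf⟩, hs, h0, h1⟩ : ∃ f : C(H, ℝ), HasCompactSupport f ∧ 0 ≤ f ∧ f 1 ≠ 0 :=
    exists_continuous_nonneg_pos 1
  exact ⟨f, hf, hs, h0, h1, hf.integral_pos_of_hasCompactSupport_nonneg_nonzero hs h0 h1⟩

-- For a fixed bump function `f`, the modular function is the quotient of `∫ f(x) dx` by `∫ f(x h)
-- dx`, and the latter varies continuously with `h`.
omit [MeasurableSpace H] [BorelSpace H] in
theorem continuous_modularFunction : Continuous (modularFunction (H := H)) := by
  borelize H
  obtain ⟨f, hf, hs, h0, h1, hpos⟩ := exists_integral_pos (Measure.haar : Measure H)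
  have key : ∀ h : H, modularFunction h =
      (∫ x, f x ∂(Measure.haar : Measure H)) / ∫ x, f (x * h) ∂(Measure.haar : Measure H) := by
    intro h
    have := (modularFunction_pos h).ne'
    rw [integral_mul_right, smul_eq_mul]
    field_simp
  have hc : Continuous fun h : H => ∫ x, f (x * h) ∂(Measure.haar : Measure H) := by
    rw [continuous_iff_continuousAt]
    intro h₀
    obtain ⟨t, ht, hth⟩ := exists_compact_mem_nhds h₀
    refine ContinuousOn.continuousAt (s := t) ?_ hth
    -- While `h` stays in the compact neighbourhood `t`, all translates of `f` are supported in the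
    -- one compact set `supp(f) t⁻¹`.
    refine continuousOn_integral_of_compact_support
      (k := (fun p : H × H => p.1 * p.2⁻¹) '' (tsupport f ×ˢ t))
      ((IsCompact.prod hs ht).image (by fun_prop)) (by fun_prop) ?_
    intro p x hp hx
    by_contra hne
    exact hx ⟨(x * p, p), ⟨subset_tsupport _ hne, hp⟩, by simp⟩
  have hne : ∀ h : H, ∫ x, f (x * h) ∂(Measure.haar : Measure H) ≠ 0 := by
    intro h
    rw [integral_mul_right, smul_eq_mul]
    exact mul_ne_zero (inv_ne_zero (modularFunction_pos h).ne') hpos.ne'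
  exact (continuous_const.div hc hne).congr fun h => (key h).symm

omit [MeasurableSpace H] [BorelSpace H] in
theorem modularFunction_pow (h : H) (n : ℕ) : modularFunction (h ^ n) = modularFunction h ^ n := by
  induction n with
  | zero => simp [modularFunction_one]
  | succ n ih => rw [pow_succ, modularFunction_mul, ih, pow_succ]

-- A compact subgroup has bounded image in the positive reals, and an element of value greater than
-- `1` would have unbounded powers.
omit [MeasurableSpace H] [BorelSpace H] in
theorem modularFunction_eq_one_of_mem {C : Subgroup H} (hC : IsCompact (C : Set H)) {h : H}
    (hh : h ∈ C) : modularFunction h = 1 := by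
  obtain ⟨M, hM⟩ := hC.bddAbove_image (continuous_modularFunction (H := H)).continuousOn
  have key : ∀ x ∈ C, modularFunction x ≤ 1 := by
    intro x hx
    by_contra! hlt
    obtain ⟨n, hn⟩ := pow_unbounded_of_one_lt M hlt
    rw [← modularFunction_pow] at hn
    exact hn.not_ge (hM ⟨_, C.pow_mem hx n, rfl⟩)
  refine le_antisymm (key h hh) ?_
  have := key _ (C.inv_mem hh)
  rw [modularFunction_inv] at this
  exact (inv_le_one₀ (modularFunction_pos h)).1 this

/-- The change of variables `x ↦ x⁻¹` in a left Haar integral. -/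
theorem integral_inv_mul_modularFunction (μ : Measure H) [μ.IsHaarMeasure] [μ.Regular]
    {f : H → ℝ} (hf : Continuous f) (hs : HasCompactSupport f) :
    ∫ x, f x⁻¹ * (modularFunction x)⁻¹ ∂μ = ∫ x, f x ∂μ := by
  obtain ⟨g, hg, hgs, hg0, hg1, hgpos⟩ := exists_integral_pos μ
  have hinv : ∀ F : H → ℝ, ∫ x, F x ∂μ.inv = ∫ x, F x⁻¹ ∂μ := fun F =>
    (MeasurableEquiv.inv H).measurableEmbedding.integral_map F
  -- This compares the left Haar measure with its inverse, which is right invariant. The inner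
  -- integrals of `g` in the comparison are explicit by `h1`, so the density comes out as the
  -- modular function.
  have h := Measure.integral_isMulLeftInvariant_isMulRightInvariant_combo (μ := μ) (ν := μ.inv)
    hf hs hg hgs hg0 hg1
  have h1 : ∀ y, ∫ z, g (z⁻¹ * y) ∂μ.inv = (modularFunction y)⁻¹ * ∫ z, g z ∂μ := by
    intro y
    rw [hinv]
    simp only [inv_inv]
    exact integral_mul_right μ g y
  simp only [h1, mul_inv, inv_inv, ← mul_assoc] at h
  rw [integral_mul_const, mul_assoc, inv_mul_cancel₀ hgpos.ne', mul_one, hinv] at h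
  rw [h]
  simp only [modularFunction_inv]

end Modular

/-! ### Gelfand pairs are unimodular -/

section Unimodular

variable {G : Type*} [Group G] [TopologicalSpace G] [IsTopologicalGroup G]
  [MeasurableSpace G] [BorelSpace G] {K : Subgroup G}

/-! ### Convolution of uniform measures on double cosets. -/

theorem continuous_doubleCoset {G : Type*} [Group G] [TopologicalSpace G] [IsTopologicalGroup G]
    {K : Subgroup G} {L : Type*} [Group L] [TopologicalSpace L] {α β : L →* K}
    (hα : Continuous α) (hβ : Continuous β) (x : G) :
    Continuous fun l => (α l : G) * x * (β l : G)⁻¹ := by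
  fun_prop

/-- The uniform measure on the double coset `K x K`, as the image of Haar measure on a compact
group `L` that acts through two homomorphisms to `K`. -/
noncomputable def doubleCosetMeasure {L : Type*} [Group L] [TopologicalSpace L]
    [IsTopologicalGroup L] [CompactSpace L] [MeasurableSpace L] [BorelSpace L] (α β : L →* K)
    (x : G) : Measure G :=
  (haarProb L).map fun l => (α l : G) * x * (β l : G)⁻¹

section

variable {L : Type*} [Group L] [TopologicalSpace L]
  [IsTopologicalGroup L] [CompactSpace L] [MeasurableSpace L] [BorelSpace L] {α β : L →* K}

theorem isProbabilityMeasure_doubleCosetMeasure (hα : Continuous α) (hβ : Continuous β) (x : G) :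
    IsProbabilityMeasure (doubleCosetMeasure α β x) :=
  Measure.isProbabilityMeasure_map (continuous_doubleCoset hα hβ x).measurable.aemeasurable

theorem regular_doubleCosetMeasure (hα : Continuous α) (hβ : Continuous β) (x : G) :
    (doubleCosetMeasure α β x).Regular := by
  have := isProbabilityMeasure_doubleCosetMeasure hα hβ x
  have : (doubleCosetMeasure α β x).InnerRegularCompactLTTop :=
    Measure.InnerRegularCompactLTTop.map_of_continuous (continuous_doubleCoset hα hβ x)
  infer_instance

theorem isBiInvariant_doubleCosetMeasure (hα : Continuous α) (hβ : Continuous β)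
    (hs : ∀ k k' : K, ∃ l, α l = k ∧ β l = k') (x : G) :
    IsBiInvariant K (doubleCosetMeasure α β x) := by
  have hm := (continuous_doubleCoset hα hβ x).measurable
  have key : ∀ T : G → G, Measurable T → (∃ l₀, ∀ l, T ((α l : G) * x * (β l : G)⁻¹) =
      (α (l₀ * l) : G) * x * (β (l₀ * l) : G)⁻¹) →
      (doubleCosetMeasure α β x).map T = doubleCosetMeasure α β x := by
    rintro T hT ⟨l₀, h⟩
    rw [doubleCosetMeasure, Measure.map_map hT hm]
    conv_rhs => rw [← map_mul_left_eq_self (haarProb L) l₀,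
      Measure.map_map hm (measurable_const_mul l₀)]
    congr 1
    exact funext h
  intro k hk
  obtain ⟨l₁, h₁, h₁'⟩ := hs ⟨k, hk⟩ 1
  obtain ⟨l₂, h₂, h₂'⟩ := hs 1 ⟨k, hk⟩⁻¹
  refine ⟨key _ (measurable_const_mul k) ⟨l₁, fun l => ?_⟩,
    key _ (measurable_mul_const k) ⟨l₂, fun l => ?_⟩⟩
  · simp [h₁, h₁', mul_assoc]
  · simp [h₂, h₂', mul_assoc]

theorem integral_doubleCosetMeasure (hα : Continuous α) (hβ : Continuous β) (x : G) {F : G → ℝ}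
    (hF : Continuous F) :
    ∫ z, F z ∂(doubleCosetMeasure α β x) = ∫ l, F ((α l : G) * x * (β l : G)⁻¹) ∂(haarProb L) :=
  integral_map_of_stronglyMeasurable (continuous_doubleCoset hα hβ x).measurable
    hF.measurable.stronglyMeasurable

variable [CompactSpace K]

/-- Of the four factors from `K` in the product of two points of the double cosets, the outer two
disappear by invariance of `F`, and the two in the middle merge into one Haar-distributed element of
`K`. -/
theorem convIntegral_doubleCosetMeasure (hα : Continuous α) (hβ : Continuous β)
    (hs : ∀ k k' : K, ∃ l, α l = k ∧ β l = k') {F : G → ℝ} (hF : Continuous F)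
    (hl : ∀ k ∈ K, ∀ z, F (k * z) = F z) (hr : ∀ k ∈ K, ∀ z, F (z * k) = F z) (x y : G) :
    convIntegral (doubleCosetMeasure α β x) (doubleCosetMeasure α β y) F =
      ∫ k : K, F (x * (k : G) * y) ∂(haarProb K) := by
  have h1 : ∀ z, ∫ w, F (z * w) ∂(doubleCosetMeasure α β y) =
      ∫ l, F (z * (α l : G) * y) ∂(haarProb L) := by
    intro z
    rw [integral_doubleCosetMeasure hα hβ y (F := fun w => F (z * w)) (by fun_prop)]
    refine integral_congr_ae (.of_forall fun l => ?_)
    simp only [← mul_assoc]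
    exact hr _ (K.inv_mem (β l).2) _
  have h2 : Continuous fun z => ∫ l, F (z * (α l : G) * y) ∂(haarProb L) :=
    continuous_integral_haarProb (by fun_prop)
  have h3 : ∀ l, ∫ l', F ((α l : G) * x * (β l : G)⁻¹ * (α l' : G) * y) ∂(haarProb L) =
      ∫ l', F (x * (α l' : G) * y) ∂(haarProb L) := by
    intro l
    -- Translating `l'` by `l₁` cancels the factor `(β l)⁻¹` that precedes `α l'`.
    obtain ⟨l₁, h₁, -⟩ := hs (β l) 1
    rw [← integral_mul_left_eq_self _ l₁]
    refine integral_congr_ae (.of_forall fun l' => ?_)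
    simp only [map_mul, h₁, Subgroup.coe_mul, mul_assoc, inv_mul_cancel_left]
    exact hl _ (α l).2 _
  have h4 : (haarProb L).map α = haarProb K :=
    haarProb_map hα fun k => (hs k 1).imp fun _ h => h.1
  rw [convIntegral]
  simp only [h1]
  rw [integral_doubleCosetMeasure hα hβ x h2]
  simp only [h3, integral_const, probReal_univ, one_smul]
  rw [← h4, integral_map_of_stronglyMeasurable hα.measurable]
  exact Continuous.stronglyMeasurable (by fun_prop)

theorem IsGelfandPair.integral_mul_comm_of_hom (hGK : IsGelfandPair K)
    (hα : Continuous α) (hβ : Continuous β)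
    (hs : ∀ k k' : K, ∃ l, α l = k ∧ β l = k') {F : G → ℝ} (hF : Continuous F)
    (hFs : HasCompactSupport F)
    (hl : ∀ k ∈ K, ∀ z, F (k * z) = F z) (hr : ∀ k ∈ K, ∀ z, F (z * k) = F z) (x y : G) :
    ∫ k : K, F (x * (k : G) * y) ∂(haarProb K) = ∫ k : K, F (y * (k : G) * x) ∂(haarProb K) := by
  have := isProbabilityMeasure_doubleCosetMeasure hα hβ x
  have := isProbabilityMeasure_doubleCosetMeasure hα hβ y
  have := regular_doubleCosetMeasure hα hβ x
  have := regular_doubleCosetMeasure hα hβ y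
  rw [← convIntegral_doubleCosetMeasure hα hβ hs hF hl hr,
    ← convIntegral_doubleCosetMeasure hα hβ hs hF hl hr]
  exact hGK _ _ (isBiInvariant_doubleCosetMeasure hα hβ hs x)
    (isBiInvariant_doubleCosetMeasure hα hβ hs y) F hF hFs

end

variable [CompactSpace K]

theorem IsGelfandPair.integral_mul_comm (hGK : IsGelfandPair K) {F : G → ℝ} (hF : Continuous F)
    (hFs : HasCompactSupport F)
    (hl : ∀ k ∈ K, ∀ z, F (k * z) = F z) (hr : ∀ k ∈ K, ∀ z, F (z * k) = F z) (x y : G) :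
    ∫ k : K, F (x * (k : G) * y) ∂(haarProb K) = ∫ k : K, F (y * (k : G) * x) ∂(haarProb K) := by
  -- Here `L` is `K × K` with its product `σ`-algebra forgotten: that one may be smaller than the
  -- Borel `σ`-algebra, which Haar measure on `L` requires.
  obtain ⟨L, _, _, _, _, α, β, hα, hβ, h⟩ : ∃ (L : Type _) (_ : Group L) (_ : TopologicalSpace L)
      (_ : IsTopologicalGroup L) (_ : CompactSpace L) (α β : L →* K), Continuous α ∧
      Continuous β ∧ ∀ k k' : K, ∃ l, α l = k ∧ β l = k' :=
    ⟨K × K, inferInstance, inferInstance, inferInstance, inferInstance, MonoidHom.fst K K,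
      MonoidHom.snd K K, continuous_fst, continuous_snd, fun k k' => ⟨(k, k'), rfl, rfl⟩⟩
  borelize L
  exact hGK.integral_mul_comm_of_hom hα hβ h hF hFs hl hr x y

/-- Averaging a compactly supported function over a compact group that acts on the space. -/
theorem hasCompactSupport_integral_haarProb {L X : Type*} [Group L] [TopologicalSpace L]
    [IsTopologicalGroup L] [CompactSpace L] [MeasurableSpace L] [BorelSpace L]
    [TopologicalSpace X] [R1Space X] {f : X → ℝ} (hf : HasCompactSupport f) {a b : L → X → X}
    (hb : Continuous b.uncurry) (hab : ∀ l x, b l (a l x) = x) :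
    HasCompactSupport fun x => ∫ l, f (a l x) ∂(haarProb L) := by
  refine HasCompactSupport.intro (K := b.uncurry '' (Set.univ ×ˢ tsupport f))
    ((isCompact_univ.prod hf).image hb) fun x hx => ?_
  have : ∀ l, f (a l x) = 0 := by
    intro l
    by_contra h
    exact hx ⟨(l, a l x), ⟨trivial, subset_tsupport _ h⟩, hab l x⟩
  simp [this]

/-- A nonnegative compactly supported continuous function can be made left `K`-invariant. -/
theorem exists_leftInvariant [LocallyCompactSpace G] [T2Space G] :
    ∃ f : G → ℝ, Continuous f ∧ HasCompactSupport f ∧ 0 ≤ f ∧ 0 < f 1 ∧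
      ∀ k ∈ K, ∀ x, f (k * x) = f x := by
  obtain ⟨⟨f, hf⟩, hs, h0, h1⟩ : ∃ f : C(G, ℝ), HasCompactSupport f ∧ 0 ≤ f ∧ f 1 ≠ 0 :=
    exists_continuous_nonneg_pos 1
  have hf : Continuous f := hf
  refine ⟨fun x => ∫ k : K, f ((k : G) * x) ∂(haarProb K),
    continuous_integral_haarProb (by fun_prop),
    hasCompactSupport_integral_haarProb hs (a := fun (k : K) x => (k : G) * x)
      (b := fun k x => (k : G)⁻¹ * x) (by fun_prop) (by simp),
    fun x => integral_nonneg fun k => h0 _, ?_, fun k hk x => ?_⟩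
  · refine Continuous.integral_pos_of_hasCompactSupport_nonneg_nonzero (x := 1) (by fun_prop)
      (HasCompactSupport.of_compactSpace _) (fun k => h0 _) ?_
    simpa using h1
  · have := integral_mul_right_eq_self (μ := haarProb K) (fun k' : K => f ((k' : G) * x)) ⟨k, hk⟩
    simpa [mul_assoc] using this

theorem exists_biInvariant [LocallyCompactSpace G] [T2Space G] :
    ∃ f : G → ℝ, Continuous f ∧ HasCompactSupport f ∧ 0 ≤ f ∧ 0 < f 1 ∧
      (∀ k ∈ K, ∀ x, f (k * x) = f x) ∧ ∀ k ∈ K, ∀ x, f (x * k) = f x := by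
  obtain ⟨f, hf, hs, h0, h1, hl⟩ := exists_leftInvariant (K := K)
  refine ⟨fun x => ∫ k : K, f (x * (k : G)) ∂(haarProb K),
    continuous_integral_haarProb (by fun_prop),
    hasCompactSupport_integral_haarProb hs (a := fun (k : K) x => x * (k : G))
      (b := fun k x => x * (k : G)⁻¹) (by fun_prop) (by simp),
    fun x => integral_nonneg fun k => h0 _, ?_, fun k hk x => ?_, fun k hk x => ?_⟩
  · refine Continuous.integral_pos_of_hasCompactSupport_nonneg_nonzero (x := 1) (by fun_prop)
      (HasCompactSupport.of_compactSpace _) (fun k => h0 _) ?_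
    simpa using h1.ne'
  · simp only [mul_assoc, hl k hk]
  · have := integral_mul_left_eq_self (μ := haarProb K) (fun k' : K => f (x * (k' : G))) ⟨k, hk⟩
    simpa [mul_assoc] using this

/-- A group that contains a Gelfand pair is unimodular. -/
theorem IsGelfandPair.modularFunction_eq_one [LocallyCompactSpace G] [T2Space G]
    (hGK : IsGelfandPair K) (y : G) : modularFunction y = 1 := by
  obtain ⟨f, hf, hs, h0, h1, hl, hr⟩ := exists_biInvariant (K := K)
  have hpos : 0 < ∫ x, f x ∂(Measure.haar : Measure G) :=
    hf.integral_pos_of_hasCompactSupport_nonneg_nonzero hs h0 h1.ne'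
  have hK : IsCompact (K : Set G) := isCompact_iff_compactSpace.2 ‹_›
  have hcomm := hGK.integral_mul_comm hf hs hl hr y
  have hC : ∀ a b : K → G → G, Continuous a.uncurry → Continuous b.uncurry →
      (∀ k x, b k (a k x) = x) →
      ∫ x, ∫ k : K, f (a k x) ∂(haarProb K) ∂(Measure.haar : Measure G) =
        ∫ k : K, ∫ x, f (a k x) ∂(Measure.haar : Measure G) ∂(haarProb K) := by
    intro a b ha hb hab
    have hc : IsCompact (b.uncurry '' (Set.univ ×ˢ tsupport f)) :=
      (isCompact_univ.prod hs).image hb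
    refine integral_haarProb_swap (f := fun x k => f (a k x))
      (hf.comp (ha.comp continuous_swap)) hc hc.isClosed fun x k hx => ?_
    by_contra h
    exact hx ⟨(k, a k x), ⟨trivial, subset_tsupport _ h⟩, hab k x⟩
  have e1 := hC (fun k x => y * (k : G) * x) (fun k x => (y * (k : G))⁻¹ * x) (by fun_prop)
    (by fun_prop) (by simp [mul_assoc])
  have e2 := hC (fun k x => x * (k : G) * y) (fun k x => x * ((k : G) * y)⁻¹) (by fun_prop)
    (by fun_prop) (by simp [mul_assoc])
  -- Both orders are now integrated over `x`: in `f(y k x)` the translation is on the left and free,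
  -- in `f(x k y)` it is on the right and costs `∇(k y)⁻¹ = ∇(y)⁻¹`.
  simp only [hcomm] at e1
  rw [e1] at e2
  have hk : ∀ k : K, modularFunction (k : G) = 1 := fun k => modularFunction_eq_one_of_mem hK k.2
  have hl' : ∀ k : K, ∫ x, f (y * (k : G) * x) ∂Measure.haar = ∫ x, f x ∂Measure.haar :=
    fun k => integral_mul_left_eq_self f _
  simp only [hl'] at e2
  simp only [mul_assoc, integral_mul_right _ f, modularFunction_mul, hk,
    one_mul, integral_const, probReal_univ, one_smul] at e2
  rw [smul_eq_mul, eq_comm, mul_eq_right₀ hpos.ne', inv_eq_one] at e2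
  exact e2

end Unimodular
/-! ### The function `ϱ` -/

section Rho

variable {G : Type*} [Group G] [TopologicalSpace G] [IsTopologicalGroup G]
  {K P : Subgroup G} [CompactSpace K] [LocallyCompactSpace P]

theorem modularFunction_eq_one_of_coe_mem (hP : IsClosed (P : Set G)) {p : P} (hp : (p : G) ∈ K) :
    modularFunction p = 1 := by
  have hK : IsCompact (K : Set G) := isCompact_iff_compactSpace.2 ‹_›
  exact modularFunction_eq_one_of_mem (C := K.subgroupOf P)
    (hP.isClosedEmbedding_subtypeVal.isCompact_preimage hK) hp

/-- Two choices of the `P`-component differ by an element of the compact group `K ∩ P`, where the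
modular function of `P` is trivial. -/
theorem rho_mul (hP : IsClosed (P : Set G)) {k : G} (hk : k ∈ K) (p : P) :
    rho K P (k * p) = modularFunction p := by
  have h : ∃ q : P, k * (p : G) * (q : G)⁻¹ ∈ K := ⟨p, by simpa using hk⟩
  rw [rho, dif_pos h]
  have h1 : modularFunction (p * h.choose⁻¹) = 1 := by
    refine modularFunction_eq_one_of_coe_mem (K := K) hP ?_
    have := K.mul_mem (K.inv_mem hk) h.choose_spec
    simpa [mul_assoc] using this
  rw [modularFunction_mul, modularFunction_inv] at h1
  exact ((mul_inv_eq_one₀ (modularFunction_pos _).ne').1 h1).symm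

variable (hP : IsClosed (P : Set G)) (hKP : ∀ g : G, ∃ k ∈ K, ∃ p ∈ P, g = k * p)
include hP hKP

theorem rho_pos (g : G) : 0 < rho K P g := by
  obtain ⟨k, hk, p, hp, rfl⟩ := hKP g
  exact (rho_mul hP hk ⟨p, hp⟩).symm ▸ modularFunction_pos _

theorem rho_mul_right (g : G) (q : P) : rho K P (g * q) = modularFunction q * rho K P g := by
  obtain ⟨k, hk, p, hp, rfl⟩ := hKP g
  have h1 := rho_mul hP hk ⟨p, hp⟩
  have h2 := rho_mul hP hk (⟨p, hp⟩ * q)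
  simp only [Subgroup.coe_mul, ← mul_assoc] at h1 h2
  rw [h1, h2, modularFunction_mul, mul_comm]

theorem rho_mul_left {k : G} (hk : k ∈ K) (g : G) : rho K P (k * g) = rho K P g := by
  obtain ⟨l, hl, p, hp, rfl⟩ := hKP g
  rw [← mul_assoc]
  exact (rho_mul hP (K.mul_mem hk hl) ⟨p, hp⟩).trans (rho_mul hP hl ⟨p, hp⟩).symm

omit hKP in
theorem rho_of_mem {k : G} (hk : k ∈ K) : rho K P k = 1 := by
  simpa [modularFunction_one] using rho_mul hP hk 1

/-- Multiplication `K × P → G` is a closed surjection, hence a quotient map, and `ϱ` pulls back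
along it to `(k, p) ↦ ∇_P(p)`. Closedness follows from compactness of `K`: after the shear `e`,
multiplication is the projection that forgets `K`. -/
theorem continuous_rho : Continuous (rho K P) := by
  let e : K × G ≃ₜ K × G :=
    { toFun := fun x => (x.1, (x.1 : G) * x.2)
      invFun := fun x => (x.1, (x.1 : G)⁻¹ * x.2)
      left_inv := fun x => by simp
      right_inv := fun x => by simp
      continuous_toFun := by fun_prop
      continuous_invFun := by fun_prop }
  have hcl : IsClosedMap fun x : K × P => (x.1 : G) * (x.2 : G) :=
    (isClosedMap_snd_of_compactSpace.comp e.isClosedMap).comp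
      (Topology.IsClosedEmbedding.id.prodMap hP.isClosedEmbedding_subtypeVal).isClosedMap
  have hsurj : Function.Surjective fun x : K × P => (x.1 : G) * (x.2 : G) := by
    intro g
    obtain ⟨k, hk, p, hp, rfl⟩ := hKP g
    exact ⟨(⟨k, hk⟩, ⟨p, hp⟩), rfl⟩
  rw [(hcl.isQuotientMap (by fun_prop) hsurj).continuous_iff]
  have : (rho K P ∘ fun x : K × P => (x.1 : G) * (x.2 : G)) = fun x => modularFunction x.2 :=
    funext fun x => rho_mul hP x.1.2 x.2
  rw [this]
  exact continuous_modularFunction.comp continuous_snd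

end Rho

theorem isClosedEmbedding_const_mul_coe {G : Type*} [Group G] [TopologicalSpace G]
    [IsTopologicalGroup G] {P : Subgroup G} (hP : IsClosed (P : Set G)) (x : G) :
    IsClosedEmbedding fun p : P => x * (p : G) :=
  (Homeomorph.mulLeft x).isClosedEmbedding.comp hP.isClosedEmbedding_subtypeVal

/-! ### Integration over `G = K P` -/

section Integration

variable {G : Type*} [Group G] [TopologicalSpace G] [IsTopologicalGroup G] [LocallyCompactSpace G]
  [T2Space G] [MeasurableSpace G] [BorelSpace G]
  {K P : Subgroup G} [CompactSpace K] [LocallyCompactSpace P]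
  (hP : IsClosed (P : Set G)) (hKP : ∀ g : G, ∃ k ∈ K, ∃ p ∈ P, g = k * p)

/-- A normalising function for integrals of densities over `G / P`: it is nonnegative, continuous,
compactly supported, and its integrals over all cosets of `P` are `1`. -/
structure IsCosetNormalized (P : Subgroup G) [LocallyCompactSpace P] (φ : G → ℝ) : Prop where
  continuous : Continuous φ
  hasCompactSupport : HasCompactSupport φ
  nonneg : ∀ x, 0 ≤ φ x
  integral_eq_one : ∀ x, ∫ p : P, φ (x * (p : G)) ∂Measure.haar = 1

include hP hKP in
theorem exists_isCosetNormalized :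
    ∃ ψ : G → ℝ, IsCosetNormalized P ψ ∧ ψ ≠ 0 ∧ ∀ k ∈ K, ∀ x, ψ (k * x) = ψ x := by
  obtain ⟨f, hf, hs, h0, h1, hl⟩ := exists_leftInvariant (K := K)
  have hpos : 0 < ∫ p : P, f p ∂Measure.haar :=
    (hf.comp continuous_subtype_val).integral_pos_of_hasCompactSupport_nonneg_nonzero (x := 1)
      (hs.comp_isClosedEmbedding hP.isClosedEmbedding_subtypeVal) (fun p => h0 _) h1.ne'
  -- Left `K`-invariance of `f` together with `G = K P` makes the integral over every coset the
  -- same, so one constant normalises all of them.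
  have h2 : ∀ x, ∫ p : P, f (x * (p : G)) ∂Measure.haar = ∫ p : P, f p ∂Measure.haar := by
    intro x
    obtain ⟨k, hk, q, hq, rfl⟩ := hKP x
    simp only [mul_assoc, hl k hk]
    exact integral_mul_left_eq_self (fun p : P => f p) ⟨q, hq⟩
  refine ⟨fun x => (∫ p : P, f p ∂Measure.haar)⁻¹ * f x,
    ⟨by fun_prop, hs.mul_left, fun x => mul_nonneg (inv_nonneg.2 hpos.le) (h0 x), fun x => ?_⟩,
    fun h => ?_, fun k hk x => by simp only [hl k hk]⟩
  · rw [integral_const_mul, h2, inv_mul_cancel₀ hpos.ne']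
  · exact mul_ne_zero (inv_ne_zero hpos.ne') h1.ne' (congrFun h 1)

variable (hG : ∀ g : G, modularFunction g = 1)
  {Φ : G → ℂ} (hΦ : Continuous Φ) (hΦP : ∀ x (p : P), Φ (x * p) = modularFunction p * Φ x)

omit [T2Space G] in
include hG hΦ hΦP hP in
/-- The integral of a density does not depend on the normalising function. -/
theorem integral_density_eq {φ ψ : G → ℝ} (hφ : Continuous φ) (hφs : HasCompactSupport φ)
    (hφ1 : ∀ x, Φ x ≠ 0 → ∫ p : P, φ (x * (p : G)) ∂Measure.haar = 1)
    (hψ : IsCosetNormalized P ψ) :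
    ∫ x, (φ x : ℂ) * Φ x ∂(Measure.haar : Measure G) =
      ∫ x, (ψ x : ℂ) * Φ x ∂(Measure.haar : Measure G) := by
  have hψc := hψ.continuous
  -- Unfolding: `1 = ∫_P ψ(x p) dp` is inserted, the integrals are swapped, and `x` is replaced by
  -- `x p⁻¹`. As `G` is unimodular, the substitution only produces the factor `∇_P(p)⁻¹` from `Φ`.
  have e1 : ∀ x, (φ x : ℂ) * Φ x =
      ∫ p : P, (φ x : ℂ) * Φ x * (ψ (x * (p : G)) : ℂ) ∂Measure.haar := by
    intro x
    rw [integral_const_mul, integral_complex_ofReal, hψ.integral_eq_one]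
    simp
  have e2 : ∀ p : P, ∫ x, (φ x : ℂ) * Φ x * (ψ (x * (p : G)) : ℂ) ∂(Measure.haar : Measure G) =
      ∫ x, (φ (x * (p : G)⁻¹) : ℂ) * ((modularFunction p)⁻¹ : ℝ) * (ψ x * Φ x)
        ∂(Measure.haar : Measure G) := by
    intro p
    have h := integral_mul_right (Measure.haar : Measure G)
      (fun x => (φ x : ℂ) * Φ x * (ψ (x * (p : G)) : ℂ)) (p : G)⁻¹
    rw [hG, inv_one, one_smul] at h
    rw [← h]
    refine integral_congr_ae (.of_forall fun x => ?_)
    have := hΦP x p⁻¹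
    simp only [Subgroup.coe_inv, modularFunction_inv] at this
    simp only [this, inv_mul_cancel_right]
    push_cast
    ring
  have e3 : ∀ x, ∫ p : P, (φ (x * (p : G)⁻¹) : ℂ) * ((modularFunction p)⁻¹ : ℝ) * (ψ x * Φ x)
      ∂Measure.haar = ψ x * Φ x := by
    intro x
    by_cases hx : Φ x = 0
    · simp [hx]
    -- The factor `∇_P(p)⁻¹` is exactly the Jacobian of `p ↦ p⁻¹`, so the integral over `P` becomes
    -- `∫_P φ(x p) dp = 1`.
    have h := integral_inv_mul_modularFunction (Measure.haar : Measure P)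
      (f := fun p => φ (x * (p : G))) (by fun_prop)
      (hφs.comp_isClosedEmbedding (isClosedEmbedding_const_mul_coe hP x))
    rw [hφ1 x hx] at h
    rw [integral_mul_const]
    simp only [← Complex.ofReal_mul]
    rw [integral_complex_ofReal]
    simp only [Subgroup.coe_inv] at h
    rw [h]
    simp
  -- If `x ∈ C` and `x p ∈ D`, then `p ∈ C⁻¹ D`. This gives the compact supports that justify both
  -- swaps without `σ`-finiteness.
  have hcP : ∀ {C D : Set G}, IsCompact C → IsCompact D →
      IsCompact ((fun p : P => (p : G)) ⁻¹' ((fun y : G × G => y.1⁻¹ * y.2) '' (C ×ˢ D))) :=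
    fun hC hD => hP.isClosedEmbedding_subtypeVal.isCompact_preimage
      ((hC.prod hD).image (by fun_prop))
  have hmod := continuous_modularFunction (H := P)
  have hmod' : ∀ p : P, modularFunction p ≠ 0 := fun p => (modularFunction_pos p).ne'
  calc _ = ∫ x, ∫ p : P, (φ x : ℂ) * Φ x * (ψ (x * (p : G)) : ℂ) ∂Measure.haar
        ∂(Measure.haar : Measure G) := integral_congr_ae (.of_forall e1)
    _ = ∫ p : P, ∫ x, (φ x : ℂ) * Φ x * (ψ (x * (p : G)) : ℂ) ∂(Measure.haar : Measure G)
        ∂Measure.haar := by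
      refine integral_integral_swap_of_hasCompactSupport (by fun_prop)
        (HasCompactSupport.intro (hφs.prod (hcP hφs hψ.hasCompactSupport)) ?_)
      rintro ⟨x, p⟩ hxp
      by_contra hne
      simp only [Function.uncurry, mul_eq_zero, not_or, Complex.ofReal_eq_zero] at hne
      exact hxp ⟨subset_tsupport _ hne.1.1, (x, x * (p : G)), ⟨subset_tsupport _ hne.1.1,
        subset_tsupport _ hne.2⟩, by simp⟩
    _ = ∫ p : P, ∫ x, (φ (x * (p : G)⁻¹) : ℂ) * ((modularFunction p)⁻¹ : ℝ) * (ψ x * Φ x)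
        ∂(Measure.haar : Measure G) ∂Measure.haar := integral_congr_ae (.of_forall e2)
    _ = ∫ x, ∫ p : P, (φ (x * (p : G)⁻¹) : ℂ) * ((modularFunction p)⁻¹ : ℝ) * (ψ x * Φ x)
        ∂Measure.haar ∂(Measure.haar : Measure G) := by
      refine (integral_integral_swap_of_hasCompactSupport (f := fun x (p : P) =>
        (φ (x * (p : G)⁻¹) : ℂ) * ((modularFunction p)⁻¹ : ℝ) * (ψ x * Φ x)) ?_
        (HasCompactSupport.intro (hψ.hasCompactSupport.prod
          (hcP hφs hψ.hasCompactSupport)) ?_)).symm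
      · have : Continuous fun p : P => (modularFunction p)⁻¹ := hmod.inv₀ hmod'
        exact ((Complex.continuous_ofReal.comp (hφ.comp (by fun_prop))).mul
          (Complex.continuous_ofReal.comp (this.comp continuous_snd))).mul (by fun_prop)
      rintro ⟨x, p⟩ hxp
      by_contra hne
      simp only [Function.uncurry, mul_eq_zero, not_or, Complex.ofReal_eq_zero] at hne
      exact hxp ⟨subset_tsupport _ hne.2.1, (x * (p : G)⁻¹, x), ⟨subset_tsupport _ hne.1.1,
        subset_tsupport _ hne.2.1⟩, by simp⟩
    _ = _ := integral_congr_ae (.of_forall e3)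

include hP hKP hΦ hΦP in
/-- The integral of a density over `G / P` is a multiple of its integral over `K`. -/
theorem integral_density_eq_integral_haarProb {ψ : G → ℝ} (hψ : IsCosetNormalized P ψ)
    (hψK : ∀ k ∈ K, ∀ x, ψ (k * x) = ψ x) :
    ∫ x, (ψ x : ℂ) * Φ x ∂(Measure.haar : Measure G) =
      (∫ x, ψ x * rho K P x ∂(Measure.haar : Measure G) : ℝ) * ∫ k : K, Φ k ∂(haarProb K) := by
  have hψc := hψ.continuous
  have e1 : ∀ k : K, ∫ x, (ψ x : ℂ) * Φ ((k : G) * x) ∂(Measure.haar : Measure G) =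
      ∫ x, (ψ x : ℂ) * Φ x ∂(Measure.haar : Measure G) := by
    intro k
    rw [← integral_mul_left_eq_self (fun x => (ψ x : ℂ) * Φ x) (k : G)]
    simp only [hψK _ k.2]
  -- Writing `x = k p`, the `K`-average of `Φ(· x)` is `∇_P(p) = ϱ(x)` times the `K`-average of `Φ`.
  have e2 : ∀ x, ∫ k : K, (ψ x : ℂ) * Φ ((k : G) * x) ∂(haarProb K) =
      ((ψ x * rho K P x : ℝ) : ℂ) * ∫ k : K, Φ k ∂(haarProb K) := by
    intro x
    obtain ⟨k, hk, p, hp, rfl⟩ := hKP x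
    have h1 : ∀ l : K, Φ ((l : G) * (k * p)) = modularFunction (⟨p, hp⟩ : P) * Φ (l * k) := by
      intro l
      rw [← hΦP, mul_assoc]
    have h2 := integral_mul_right_eq_self (μ := haarProb K) (fun l : K => Φ l) ⟨k, hk⟩
    simp only [Subgroup.coe_mul] at h2
    simp only [h1, integral_const_mul, h2]
    rw [rho_mul hP hk ⟨p, hp⟩]
    push_cast
    ring
  have hs : IsCompact (tsupport ψ) := hψ.hasCompactSupport
  calc _ = ∫ _k : K, ∫ x, (ψ x : ℂ) * Φ x ∂(Measure.haar : Measure G) ∂(haarProb K) := by simp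
    _ = ∫ k : K, ∫ x, (ψ x : ℂ) * Φ ((k : G) * x) ∂(Measure.haar : Measure G) ∂(haarProb K) := by
      simp only [e1]
    _ = ∫ x, ∫ k : K, (ψ x : ℂ) * Φ ((k : G) * x) ∂(haarProb K) ∂(Measure.haar : Measure G) := by
      refine (integral_haarProb_swap (f := fun x (k : K) => (ψ x : ℂ) * Φ ((k : G) * x))
        (by fun_prop) hs hs.isClosed fun x k hx => ?_).symm
      simp [image_eq_zero_of_notMem_tsupport hx]
    _ = _ := by
      simp only [e2]
      rw [integral_mul_const, integral_complex_ofReal]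

end Integration

/-! ### Unitary representations -/

section Unitary

variable {G : Type*} [Group G] [TopologicalSpace G] [IsTopologicalGroup G]

/-- An isometric action with continuous diagonal coefficients is strongly continuous. -/
theorem continuous_of_continuous_inner {E : Type*} [SeminormedAddCommGroup E]
    [InnerProductSpace ℂ E] (ρ : G → E → E) (hρ : ∀ g h v, ρ (g * h) v = ρ g (ρ h v))
    (hinv : ∀ g v w, inner ℂ (ρ g v) (ρ g w) = inner ℂ v w) {v : E}
    (hv : Continuous fun g => inner ℂ v (ρ g v)) : Continuous fun g => ρ g v := by
  have hn : ∀ g, ‖ρ g v‖ = ‖v‖ := fun g => by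
    rw [norm_eq_sqrt_re_inner (𝕜 := ℂ), hinv, ← norm_eq_sqrt_re_inner]
  rw [continuous_iff_continuousAt]
  intro g₀
  rw [ContinuousAt, tendsto_iff_norm_sub_tendsto_zero]
  -- Expanding the square and using invariance, only the diagonal coefficient at `g₀⁻¹ g` remains.
  have h1 : ∀ g, ‖ρ g v - ρ g₀ v‖ ^ 2 =
      2 * (inner ℂ v (ρ (g₀⁻¹ * g₀) v) - inner ℂ v (ρ (g₀⁻¹ * g) v)).re := by
    intro g
    have h2 : ∀ g, inner ℂ v (ρ (g₀⁻¹ * g) v) = inner ℂ (ρ g₀ v) (ρ g v) := by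
      intro g
      rw [← hinv g₀, ← hρ, mul_inv_cancel_left]
    rw [h2, h2, inner_self_eq_norm_sq_to_K, norm_sub_sq (𝕜 := ℂ), hn, hn,
      ← inner_conj_symm (ρ g v)]
    simp [← Complex.ofReal_pow]
    rw [← inner_conj_symm (ρ g v), Complex.conj_re]
    ring
  have h2 : Continuous fun g =>
      2 * (inner ℂ v (ρ (g₀⁻¹ * g₀) v) - inner ℂ v (ρ (g₀⁻¹ * g) v)).re :=
    continuous_const.mul (Complex.continuous_re.comp
      (continuous_const.sub (hv.comp (continuous_const_mul g₀⁻¹))))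
  have h3 := (h2.tendsto g₀).sqrt
  simpa only [← h1, Real.sqrt_sq (norm_nonneg _), sub_self, norm_zero, Complex.zero_re, mul_zero, Real.sqrt_zero] using h3

omit [Group G] [IsTopologicalGroup G] in
theorem continuous_apply_of_dense {H : Type*} [NormedAddCommGroup H] [InnerProductSpace ℂ H]
    [CompleteSpace H] (π : G → unitary (H →L[ℂ] H)) {ι : Type*} {J : ι → H} (hJ : DenseRange J)
    (h : ∀ i, Continuous fun g => (π g : H →L[ℂ] H) (J i)) (v : H) :
    Continuous fun g => (π g : H →L[ℂ] H) v := by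
  refine continuous_of_uniform_approx_of_continuous fun U hU => ?_
  obtain ⟨ε, hε, hU⟩ := Metric.mem_uniformity_dist.1 hU
  obtain ⟨i, hi⟩ := hJ.exists_dist_lt v hε
  refine ⟨fun g => (π g : H →L[ℂ] H) (J i), h i, fun g => hU ?_⟩
  rw [dist_eq_norm, ← map_sub, Unitary.norm_map, ← dist_eq_norm]
  exact hi

/-- The completion of an isometric representation on a pre-Hilbert space. -/
theorem exists_unitary_completion {V : Type u} [AddCommGroup V] [Module ℂ V]
    (core : PreInnerProductSpace.Core ℂ V) (ρ : Representation ℂ G V)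
    (hinv : ∀ g v w, core.inner (ρ g v) (ρ g w) = core.inner v w)
    (hcont : ∀ v, Continuous fun g => core.inner v (ρ g v)) :
    ∃ (H : Type u) (_ : NormedAddCommGroup H) (_ : InnerProductSpace ℂ H) (_ : CompleteSpace H)
      (π : G →* unitary (H →L[ℂ] H)) (J : V →ₗ[ℂ] H),
      (∀ v : H, Continuous fun g : G => (π g : H →L[ℂ] H) v) ∧ DenseRange J ∧
      (∀ g v, J (ρ g v) = (π g : H →L[ℂ] H) (J v)) ∧
      ∀ v w, inner ℂ (J v) (J w) = core.inner v w := by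
  let _ : SeminormedAddCommGroup V :=
    @InnerProductSpace.Core.toSeminormedAddCommGroup ℂ V _ _ _ core
  let _ : InnerProductSpace ℂ V := InnerProductSpace.ofCore core
  -- The completion is separated, so null vectors of the semi-inner product die in it and
  -- definiteness need not be known.
  let J : V →ₗᵢ[ℂ] UniformSpace.Completion V := UniformSpace.Completion.toComplₗᵢ
  have hJ : DenseRange J := UniformSpace.Completion.denseRange_coe
  have hn : ∀ g v, ‖ρ g v‖ = ‖v‖ := fun g v => by
    rw [norm_eq_sqrt_re_inner (𝕜 := ℂ), norm_eq_sqrt_re_inner (𝕜 := ℂ) v]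
    exact congrArg (fun z : ℂ => √z.re) (hinv g v v)
  let e : G → V ≃ₗ[ℂ] V := fun g => LinearEquiv.ofLinearMap (ρ g) (ρ g⁻¹)
    (by rw [← Module.End.mul_eq_comp, ← map_mul]; simp; rfl)
    (by rw [← Module.End.mul_eq_comp, ← map_mul]; simp; rfl)
  have he : ∀ g v, ‖J (e g v)‖ = ‖J v‖ := fun g v => by
    rw [J.norm_map, J.norm_map]; exact hn g v
  let T : G → UniformSpace.Completion V ≃ₗᵢ[ℂ] UniformSpace.Completion V := fun g =>
    (e g).extendOfIsometry J.toLinearMap J.toLinearMap hJ hJ (he g)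
  have hT : ∀ g v, T g (J v) = J (ρ g v) := fun g v =>
    LinearEquiv.extendOfIsometry_eq (e g) J.toLinearMap J.toLinearMap hJ hJ (he g) v
  let T' : G →* (UniformSpace.Completion V ≃ₗᵢ[ℂ] UniformSpace.Completion V) :=
    { toFun := T
      map_one' := by
        refine LinearIsometryEquiv.ext fun v => ?_
        refine congrFun (hJ.equalizer (T 1).continuous continuous_id (funext fun v => ?_)) v
        simp [hT]
      map_mul' := fun g h => by
        refine LinearIsometryEquiv.ext fun v => ?_
        refine congrFun (hJ.equalizer (T (g * h)).continuous
          ((T g).continuous.comp (T h).continuous) (funext fun v => ?_)) v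
        simp [hT] }
  let π : G →* unitary (UniformSpace.Completion V →L[ℂ] UniformSpace.Completion V) :=
    (Unitary.linearIsometryEquiv.symm : _ ≃* _).toMonoidHom.comp T'
  have hπ : ∀ g v, J (ρ g v) = (π g : _ →L[ℂ] _) (J v) := fun g v => (hT g v).symm
  refine ⟨UniformSpace.Completion V, inferInstance, inferInstance, inferInstance, π,
    J.toLinearMap, continuous_apply_of_dense π hJ fun v => ?_, hJ, hπ, fun v w => J.inner_map_map v w⟩
  have := J.continuous.comp (continuous_of_continuous_inner (fun g v => ρ g v)
    (fun g h v => by simp) hinv (hcont v))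
  simpa only [Function.comp_def, hπ] using this

end Unitary

/-! ### Positive-definite functions -/

section PositiveDefinite

/-- A functional that is bounded by the seminorm `‖T ·‖` is represented by a vector. -/
theorem exists_inner_eq_of_norm_le {V H : Type*} [AddCommGroup V] [Module ℂ V]
    [NormedAddCommGroup H] [InnerProductSpace ℂ H] [CompleteSpace H] (T : V →ₗ[ℂ] H)
    (ℓ : V →ₗ[ℂ] ℂ) {C : ℝ} (h : ∀ v, ‖ℓ v‖ ≤ C * ‖T v‖) : ∃ u : H, ∀ v, ℓ v = inner ℂ u (T v) := by
  obtain ⟨f, hf, -⟩ := exists_extension_norm_eq _ (ℓ.compLeftInverse T)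
  refine ⟨(InnerProductSpace.toDual ℂ H).symm f, fun v => ?_⟩
  rw [InnerProductSpace.toDual_symm_apply]
  exact ((hf ⟨T v, v, rfl⟩).trans (LinearMap.compLeftInverse_apply_of_bdd ℓ T ⟨C, h⟩ v _ rfl)).symm

variable {G : Type*} [Group G]

/-- The sesquilinear form on the group algebra that is defined by a function on the group. -/
noncomputable def groupForm (ψ : G → ℂ) (a b : G →₀ ℂ) : ℂ :=
  a.sum fun g x => conj x * b.sum fun h y => y * ψ (g⁻¹ * h)

theorem groupForm_add (ψ₁ ψ₂ : G → ℂ) (a b : G →₀ ℂ) :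
    groupForm (ψ₁ + ψ₂) a b = groupForm ψ₁ a b + groupForm ψ₂ a b := by
  simp only [groupForm, Pi.add_apply, mul_add, Finsupp.sum_add]

theorem groupForm_single_left (ψ : G → ℂ) (g : G) (x : ℂ) (b : G →₀ ℂ) :
    groupForm ψ (Finsupp.single g x) b = conj x * b.sum fun h y => y * ψ (g⁻¹ * h) := by
  rw [groupForm, Finsupp.sum_single_index (by simp)]

theorem groupForm_add_left (ψ : G → ℂ) (a a' b : G →₀ ℂ) :
    groupForm ψ (a + a') b = groupForm ψ a b + groupForm ψ a' b := by
  classical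
  exact Finsupp.sum_add_index (by simp) (by simp [add_mul])

theorem groupForm_smul_left (ψ : G → ℂ) (a b : G →₀ ℂ) (r : ℂ) :
    groupForm ψ (r • a) b = conj r * groupForm ψ a b := by
  rw [groupForm, Finsupp.sum_smul_index (by simp), groupForm, Finsupp.mul_sum]
  simp [mul_assoc]

theorem IsPositiveDefinite.map_inv {ψ : G → ℂ} (hψ : IsPositiveDefinite ψ) (g : G) :
    ψ g⁻¹ = conj (ψ g) := by
  -- The form at the points `1, g` with coefficients `1, c` is real; `c = 0, 1, i` then determine
  -- the real and imaginary parts.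
  have h : ∀ c : ℂ, ((1 + conj c * c) * ψ 1 + c * ψ g + conj c * ψ g⁻¹).im = 0 := by
    intro c
    have := (Complex.nonneg_iff.1 (hψ 2 ![1, g] ![1, c])).2
    simp only [Fin.sum_univ_two, Matrix.cons_val_zero, Matrix.cons_val_one, map_one, one_mul,
      inv_one, mul_one, inv_mul_cancel] at this
    rw [this]
    congr 1
    ring
  have h0 := h 0
  have h1 := h 1
  have h2 := h Complex.I
  simp at h0 h1 h2
  apply Complex.ext
  · simp
    linarith
  · simp
    linarith

theorem IsPositiveDefinite.groupForm_self_nonneg {ψ : G → ℂ} (hψ : IsPositiveDefinite ψ)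
    (a : G →₀ ℂ) : 0 ≤ groupForm ψ a a := by
  have e := a.support.equivFin.symm
  have h := hψ _ (fun i => (e i : G)) (fun i => a (e i))
  have key : ∀ f : G → ℂ, ∑ i, f (e i) = ∑ g ∈ a.support, f g := fun f => by
    rw [e.sum_comp (fun x => f x), Finset.sum_coe_sort]
  simp only [groupForm, Finsupp.sum, Finset.mul_sum]
  rw [← key]
  refine h.trans_eq (Finset.sum_congr rfl fun i _ => ?_)
  rw [← key]
  simp only [mul_assoc]

theorem IsPositiveDefinite.groupForm_symm {ψ : G → ℂ} (hψ : IsPositiveDefinite ψ)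
    (a b : G →₀ ℂ) : conj (groupForm ψ b a) = groupForm ψ a b := by
  simp only [groupForm, Finsupp.sum, Finset.mul_sum, map_sum, map_mul, Complex.conj_conj]
  rw [Finset.sum_comm]
  refine Finset.sum_congr rfl fun g _ => Finset.sum_congr rfl fun h _ => ?_
  rw [← hψ.map_inv, mul_inv_rev, inv_inv]
  ring

theorem IsPositiveDefinite.norm_groupForm_sq_le {ψ : G → ℂ} (hψ : IsPositiveDefinite ψ)
    (a b : G →₀ ℂ) :
    ‖groupForm ψ a b‖ ^ 2 ≤ (groupForm ψ a a).re * (groupForm ψ b b).re := by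
  let core : PreInnerProductSpace.Core ℂ (G →₀ ℂ) :=
    { inner := groupForm ψ
      conj_inner_symm := hψ.groupForm_symm
      re_inner_nonneg := fun a => (Complex.nonneg_iff.1 (hψ.groupForm_self_nonneg a)).1
      add_left := groupForm_add_left ψ
      smul_left := groupForm_smul_left ψ }
  have h : ‖groupForm ψ a b‖ * ‖groupForm ψ b a‖ ≤ _ :=
    @InnerProductSpace.Core.inner_mul_inner_self_le ℂ (G →₀ ℂ) _ _ _ core a b
  rwa [← hψ.groupForm_symm b a, RCLike.norm_conj, ← sq] at h

variable {H : Type*} [NormedAddCommGroup H] [InnerProductSpace ℂ H] [CompleteSpace H]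
  (π : G →* unitary (H →L[ℂ] H)) (w : H)

theorem inner_unitary_mul_right (x y : G) (v w : H) :
    inner ℂ ((π x : H →L[ℂ] H) v) ((π y : H →L[ℂ] H) w) =
      inner ℂ v ((π (x⁻¹ * y) : H →L[ℂ] H) w) := by
  rw [← Unitary.inner_map_map (π x) v, ← mul_apply_eq_comp, ← Submonoid.coe_mul,
    ← map_mul, mul_inv_cancel_left]

theorem groupForm_inner (a b : G →₀ ℂ) :
    groupForm (fun g => inner ℂ w ((π g : H →L[ℂ] H) w)) a b =
      inner ℂ (Finsupp.linearCombination ℂ (fun g => (π g : H →L[ℂ] H) w) a)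
        (Finsupp.linearCombination ℂ (fun g => (π g : H →L[ℂ] H) w) b) := by
  simp only [groupForm, Finsupp.linearCombination_apply, Finsupp.sum, sum_inner,
    Finset.mul_sum]
  simp only [inner_sum, inner_smul_left, inner_smul_right, inner_unitary_mul_right,
    mul_left_comm]

theorem isPositiveDefinite_inner :
    IsPositiveDefinite fun g => inner ℂ w ((π g : H →L[ℂ] H) w) := by
  intro n g c
  have : ∑ i, ∑ j, conj (c i) * c j * inner ℂ w ((π ((g i)⁻¹ * g j) : H →L[ℂ] H) w) =
      inner ℂ (∑ i, c i • (π (g i) : H →L[ℂ] H) w) (∑ i, c i • (π (g i) : H →L[ℂ] H) w) := by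
    simp only [sum_inner]
    simp only [inner_sum, inner_smul_left, inner_smul_right, inner_unitary_mul_right, mul_assoc,
      mul_left_comm]
  rw [this, inner_self_eq_norm_sq_to_K, RCLike.ofReal_eq_complex_ofReal, ← Complex.ofReal_pow]
  exact Complex.zero_le_real.2 (sq_nonneg _)

end PositiveDefinite

/-! ### Representations with a one-dimensional space of `K`-fixed vectors -/

section Spherical

variable {G : Type*} [Group G] [TopologicalSpace G] [IsTopologicalGroup G]
  [MeasurableSpace G] [BorelSpace G] {K : Subgroup G} [CompactSpace K]
  {H : Type*} [NormedAddCommGroup H] [InnerProductSpace ℂ H] [CompleteSpace H]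
  {π : G →* unitary (H →L[ℂ] H)} {w : H}

theorem eq_smul_of_average (havg : ∀ u v : H,
      ∫ k : K, inner ℂ u ((π k : H →L[ℂ] H) v) ∂(haarProb K) = inner ℂ u w * inner ℂ w v)
    {v : H} (hv : ∀ k ∈ K, (π k : H →L[ℂ] H) v = v) : v = inner ℂ w v • w := by
  refine ext_inner_left ℂ fun u => ?_
  have h := havg u v
  simp only [hv _ (Subtype.prop _), integral_const, probReal_univ, one_smul] at h
  rw [h, inner_smul_right, mul_comm]

variable (havg : ∀ u v : H,
    ∫ k : K, inner ℂ u ((π k : H →L[ℂ] H) v) ∂(haarProb K) = inner ℂ u w * inner ℂ w v)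
  (hw : ‖w‖ = 1) (hwK : ∀ k ∈ K, (π k : H →L[ℂ] H) w = w)
  (hc : Continuous fun g : G => inner ℂ w ((π g : H →L[ℂ] H) w))

-- The functional equation is `havg` applied to `u = π(x⁻¹) w` and `v = π(y) w`.
include havg hw hc in
theorem isSpherical_inner : IsSpherical K fun g => inner ℂ w ((π g : H →L[ℂ] H) w) := by
  refine ⟨hc, fun h => ?_, fun x y => ?_⟩
  · have := congrFun h 1
    simp [inner_self_eq_norm_sq_to_K, hw] at this
  · have h := havg ((π x⁻¹ : H →L[ℂ] H) w) ((π y : H →L[ℂ] H) w)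
    have h1 := inner_unitary_mul_right π x⁻¹ 1 w w
    simp only [inv_inv, mul_one, map_one, OneMemClass.coe_one, one_apply_eq_self] at h1
    refine (congrArg (· * _) h1).symm.trans (h.symm.trans ?_)
    refine integral_congr_ae (.of_forall fun k => ?_)
    have h2 := inner_unitary_mul_right π x⁻¹ ((k : G) * y) w w
    simp only [inv_inv, ← mul_assoc] at h2
    simpa only [map_mul, Submonoid.coe_mul, mul_apply_eq_comp] using h2

-- A summand `ψ₁` of `φ` has a form on the group algebra dominated by that of `φ`. By Cauchy–Schwarz
-- and Riesz it is a coefficient `⟨u, π(g) w⟩`; averaging it over `K` with `havg` gives `⟨u, w⟩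
-- φ(g)`, and `⟨u, w⟩ = ψ₁(1)`.
include havg hw hwK hc in
theorem isPure_inner : IsPure fun g => inner ℂ w ((π g : H →L[ℂ] H) w) := by
  refine ⟨(isSpherical_inner havg hw hc).2.1, hc, isPositiveDefinite_inner π w, ?_⟩
  intro ψ₁ ψ₂ hψ₁ hp₁ hψ₂ hp₂ hsum
  set φ : G → ℂ := fun g => inner ℂ w ((π g : H →L[ℂ] H) w) with hφ
  let T := Finsupp.linearCombination ℂ (fun g => (π g : H →L[ℂ] H) w)
  have hle : ∀ b, (groupForm ψ₁ b b).re ≤ ‖T b‖ ^ 2 := by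
    intro b
    have h1 : groupForm φ b b = _ := groupForm_inner π w b b
    rw [hsum, groupForm_add, inner_self_eq_norm_sq_to_K] at h1
    have h2 := congrArg Complex.re h1
    have h3 := (Complex.nonneg_iff.1 (hp₂.groupForm_self_nonneg b)).1
    rw [Complex.add_re, RCLike.ofReal_eq_complex_ofReal, ← Complex.ofReal_pow,
      Complex.ofReal_re] at h2
    exact (le_add_of_nonneg_right h3).trans h2.le
  let ℓ : (G →₀ ℂ) →ₗ[ℂ] ℂ := Finsupp.linearCombination ℂ ψ₁
  have hℓ : ∀ b, ℓ b = groupForm ψ₁ (Finsupp.single 1 1) b := by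
    intro b
    simp [groupForm_single_left, ℓ, Finsupp.linearCombination_apply]
  have h11 : groupForm ψ₁ (Finsupp.single 1 1) (Finsupp.single 1 1) = ψ₁ 1 := by
    simp [groupForm_single_left]
  have hψ1 : 0 ≤ ψ₁ 1 := h11 ▸ hp₁.groupForm_self_nonneg _
  obtain ⟨hre, him⟩ := Complex.nonneg_iff.1 hψ1
  obtain ⟨u, hu⟩ := exists_inner_eq_of_norm_le T ℓ (C := √(ψ₁ 1).re) fun b => by
    refine abs_le_of_sq_le_sq' ?_ (by positivity) |>.2
    rw [hℓ, mul_pow, Real.sq_sqrt hre]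
    refine (hp₁.norm_groupForm_sq_le _ b).trans ?_
    rw [h11]
    exact mul_le_mul_of_nonneg_left (hle b) hre
  have hu' : ∀ g, ψ₁ g = inner ℂ u ((π g : H →L[ℂ] H) w) := by
    intro g
    simpa [ℓ, T] using hu (Finsupp.single g 1)
  -- The vector `u` is not known to be `K`-fixed, so invariance comes from domination: `δ_{k⁻¹} -
  -- δ_1` is null for `φ` because `w` is fixed, hence null for `ψ₁`, hence `ψ₁`-orthogonal to `δ_g`.
  have hinv : ∀ k ∈ K, ∀ g, ψ₁ (k * g) = ψ₁ g := by
    intro k hk g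
    have h1 := hp₁.norm_groupForm_sq_le (Finsupp.single k⁻¹ 1 + (-1 : ℂ) • Finsupp.single 1 1)
      (Finsupp.single g 1)
    have h2 : T (Finsupp.single k⁻¹ 1 + (-1 : ℂ) • Finsupp.single 1 1) = 0 := by
      have h := hwK _ (K.inv_mem hk)
      simp only [T, map_add, map_smul, Finsupp.linearCombination_single, h]
      simp
    have h3 := hle (Finsupp.single k⁻¹ 1 + (-1 : ℂ) • Finsupp.single 1 1)
    rw [h2, norm_zero, zero_pow two_ne_zero] at h3
    have h4 := (Complex.nonneg_iff.1 (hp₁.groupForm_self_nonneg (Finsupp.single g 1))).1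
    have h5 := h1.trans (mul_nonpos_of_nonpos_of_nonneg h3 h4)
    rw [sq_nonpos_iff, norm_eq_zero, groupForm_add_left, groupForm_smul_left,
      groupForm_single_left, groupForm_single_left] at h5
    simp only [map_one, map_neg, inv_inv, one_mul, inv_one, neg_mul, Finsupp.sum_single_index,
      zero_mul] at h5
    exact add_neg_eq_zero.1 h5
  refine ⟨(ψ₁ 1).re, fun g => ?_⟩
  have h := havg u ((π g : H →L[ℂ] H) w)
  have h1 : ∀ k : K, inner ℂ u ((π k : H →L[ℂ] H) ((π g : H →L[ℂ] H) w)) = ψ₁ g := by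
    intro k
    rw [← hinv k k.2 g, hu']
    simp
  have h2 : inner ℂ u w = ((ψ₁ 1).re : ℂ) := by
    rw [← Complex.eq_re_of_ofReal_le hψ1, hu']
    simp
  simp only [h1, integral_const, probReal_univ, one_smul] at h
  rw [h, h2]

end Spherical

/-! ### Sections of the representations induced from powers of the modular function -/

section Sections

variable {G : Type u} [Group G] [TopologicalSpace G] [IsTopologicalGroup G] [LocallyCompactSpace G]
  {K P : Subgroup G} [CompactSpace K] [LocallyCompactSpace P]

omit [CompactSpace K] [LocallyCompactSpace G] in
theorem modularPower_apply (s : ℂ) (p : P) :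
    modularPower P s p = (modularFunction p : ℂ) ^ (Complex.I * s) := rfl

theorem sqrt_mul_modularPower (hG : ∀ g : G, modularFunction g = 1) (s : ℂ) (p : P) :
    (Real.sqrt (modularFunction p / modularFunction (p : G)) : ℂ) * modularPower P s p =
      (modularFunction p : ℂ) ^ (1 / 2 + Complex.I * s) := by
  have hp := modularFunction_pos p
  rw [hG, div_one, Real.sqrt_eq_rpow, Complex.ofReal_cpow hp.le, modularPower_apply,
    Complex.cpow_add _ _ (by exact_mod_cast hp.ne')]
  norm_num

theorem section_mul_right (hG : ∀ g : G, modularFunction g = 1) {s : ℂ}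
    (F : inducedSections P (modularPower P s)) (x : G) (p : P) :
    F.1 (x * p) = (modularFunction p : ℂ) ^ (1 / 2 + Complex.I * s) * F.1 x := by
  rw [F.2.2.2, sqrt_mul_modularPower hG]

theorem continuous_section {s : ℂ} (F : inducedSections P (modularPower P s)) :
    Continuous F.1 := F.2.1

variable (hP : IsClosed (P : Set G)) (hKP : ∀ g : G, ∃ k ∈ K, ∃ p ∈ P, g = k * p)
  (hG : ∀ g : G, modularFunction g = 1)

omit [LocallyCompactSpace G] in
include hP hKP in
theorem continuous_rho_cpow (z : ℂ) : Continuous fun x => (rho K P x : ℂ) ^ z :=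
  (Complex.continuous_ofReal.comp (continuous_rho hP hKP)).cpow continuous_const
    fun x => Or.inl (rho_pos hP hKP x)

/-- The `K`-fixed section `ϱ ^ (1/2 + i s)`. -/
noncomputable def sphericalSection (s : ℂ) : inducedSections P (modularPower P s) :=
  ⟨fun x => (rho K P x : ℂ) ^ (1 / 2 + Complex.I * s), continuous_rho_cpow hP hKP _,
    ⟨K, isCompact_iff_compactSpace.2 ‹_›, fun x _ => by
      obtain ⟨k, hk, p, hp, rfl⟩ := hKP x
      exact ⟨k, hk, ⟨p, hp⟩, rfl⟩⟩, fun x p => by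
      rw [sqrt_mul_modularPower hG]
      beta_reduce
      rw [rho_mul_right hP hKP, Complex.ofReal_mul,
        Complex.mul_cpow_ofReal_nonneg (modularFunction_pos p).le (rho_pos hP hKP x).le]⟩

theorem sphericalSection_apply (s : ℂ) (x : G) :
    (sphericalSection hP hKP hG s).1 x = (rho K P x : ℂ) ^ (1 / 2 + Complex.I * s) := rfl

theorem sectionRep_apply (s : ℂ) (g : G) (F : inducedSections P (modularPower P s)) (x : G) :
    (sectionRep P (modularPower P s) g F).1 x = F.1 (g⁻¹ * x) := rfl

theorem sphericalSection_coe (s : ℂ) (k : K) : (sphericalSection hP hKP hG s).1 k = 1 := by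
  rw [sphericalSection_apply, rho_of_mem hP k.2, Complex.ofReal_one, Complex.one_cpow]

theorem sectionRep_sphericalSection (s : ℂ) {k : G} (hk : k ∈ K) :
    sectionRep P (modularPower P s) k (sphericalSection hP hKP hG s) =
      sphericalSection hP hKP hG s := by
  refine Subtype.ext (funext fun x => ?_)
  rw [sectionRep_apply, sphericalSection_apply, rho_mul_left hP hKP (K.inv_mem hk),
    sphericalSection_apply]

theorem eq_smul_sphericalSection {s : ℂ} {F : inducedSections P (modularPower P s)}
    (hF : ∀ k ∈ K, sectionRep P (modularPower P s) k F = F) :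
    F = F.1 1 • sphericalSection hP hKP hG s := by
  refine Subtype.ext (funext fun x => ?_)
  obtain ⟨k, hk, p, hp, rfl⟩ := hKP x
  have h1 : F.1 (k * p) = F.1 p := by
    conv_lhs => rw [← hF k hk]
    rw [sectionRep_apply, inv_mul_cancel_left]
  have h2 := section_mul_right hG F 1 ⟨p, hp⟩
  rw [one_mul] at h2
  change _ = F.1 1 * (rho K P (k * p) : ℂ) ^ (1 / 2 + Complex.I * s)
  rw [h1, h2, rho_mul hP hk ⟨p, hp⟩, mul_comm]

variable [MeasurableSpace G] [BorelSpace G]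

theorem isFixedUnitSection_sphericalSection (s : ℂ) :
    IsFixedUnitSection K P (modularPower P s) (sphericalSection hP hKP hG s) := by
  refine ⟨?_, fun k hk => sectionRep_sphericalSection hP hKP hG s hk⟩
  simp only [sphericalSection_coe]
  simp

include hP hKP hG in
theorem IsFixedUnitSection.norm_apply_one {s : ℂ} {F : inducedSections P (modularPower P s)}
    (hF : IsFixedUnitSection K P (modularPower P s) F) : ‖F.1 1‖ = 1 := by
  have h := hF.1
  have h1 : ∀ k : K, F.1 k = F.1 1 := by
    intro k
    rw [eq_smul_sphericalSection hP hKP hG hF.2]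
    change F.1 1 * (sphericalSection hP hKP hG s).1 k =
      F.1 1 * (sphericalSection hP hKP hG s).1 (1 : K)
    rw [sphericalSection_coe, sphericalSection_coe]
  simp only [h1, integral_const, probReal_univ, one_smul] at h
  exact (pow_eq_one_iff_of_nonneg (norm_nonneg _) two_ne_zero).1 h

include hP hKP hG in
theorem IsFixedUnitSection.exists_eq_smul {s : ℂ} {F₁ F₂ : inducedSections P (modularPower P s)}
    (h₁ : IsFixedUnitSection K P (modularPower P s) F₁)
    (h₂ : IsFixedUnitSection K P (modularPower P s) F₂) : ∃ c : ℂ, ‖c‖ = 1 ∧ F₂ = c • F₁ := by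
  have e₁ := eq_smul_sphericalSection hP hKP hG h₁.2
  have e₂ := eq_smul_sphericalSection hP hKP hG h₂.2
  have n₁ := h₁.norm_apply_one hP hKP hG
  have n₂ := h₂.norm_apply_one hP hKP hG
  have hne : F₁.1 1 ≠ 0 := fun h => by simp [h] at n₁
  refine ⟨F₂.1 1 * (F₁.1 1)⁻¹, by simp [n₁, n₂], ?_⟩
  have e : (F₁.1 1)⁻¹ • F₁ = sphericalSection hP hKP hG s := by
    rw [inv_smul_eq_iff₀ hne]
    exact e₁
  rw [mul_smul, e]
  exact e₂

theorem phi_eq_integral_sphericalSection (s : ℂ) (g : G) :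
    phi K P s g = ∫ k : K, conj ((sphericalSection hP hKP hG s).1 k) *
      (sectionRep P (modularPower P s) g (sphericalSection hP hKP hG s)).1 k ∂(haarProb K) := by
  simp only [sphericalSection_coe, map_one, one_mul]
  rfl

include hP hKP hG in
theorem IsFixedUnitSection.phi_eq {s : ℂ} {F : inducedSections P (modularPower P s)}
    (hF : IsFixedUnitSection K P (modularPower P s) F) (g : G) :
    phi K P s g = ∫ k : K, conj (F.1 k) *
      (sectionRep P (modularPower P s) g F).1 k ∂(haarProb K) := by
  have e : ∀ x, F.1 x = F.1 1 * (sphericalSection hP hKP hG s).1 x :=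
    fun x => congrFun (congrArg Subtype.val (eq_smul_sphericalSection hP hKP hG hF.2)) x
  have hc : conj (F.1 1) * F.1 1 = 1 := by
    rw [Complex.conj_mul', hF.norm_apply_one hP hKP hG]
    simp
  rw [phi_eq_integral_sphericalSection hP hKP hG]
  refine integral_congr_ae (.of_forall fun k => ?_)
  simp only [sectionRep_apply]
  rw [e k, e (g⁻¹ * k), map_mul, mul_mul_mul_comm, hc, one_mul]

end Sections

/-! ### The inner product of sections -/

section InnerProduct

variable {G : Type u} [Group G] [TopologicalSpace G] [IsTopologicalGroup G] [LocallyCompactSpace G]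
  [MeasurableSpace G] [BorelSpace G]
  {K P : Subgroup G} [CompactSpace K] [LocallyCompactSpace P]

/-- The inner product of the restrictions of two sections to `K`. -/
noncomputable def sectionInner (K : Subgroup G) [CompactSpace K] {s : ℂ}
    (F₁ F₂ : inducedSections P (modularPower P s)) : ℂ :=
  ∫ k : K, conj (F₁.1 k) * F₂.1 k ∂(haarProb K)

omit [MeasurableSpace G] [BorelSpace G] in
theorem conj_section_mul_section (hG : ∀ g : G, modularFunction g = 1) {s : ℝ}
    (F₁ F₂ : inducedSections P (modularPower P (s : ℂ))) (x : G) (p : P) :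
    conj (F₁.1 (x * p)) * F₂.1 (x * p) = modularFunction p * (conj (F₁.1 x) * F₂.1 x) := by
  have hp := modularFunction_pos p
  have h : conj ((modularFunction p : ℂ) ^ (1 / 2 + Complex.I * s)) *
      (modularFunction p : ℂ) ^ (1 / 2 + Complex.I * (s : ℂ)) = modularFunction p := by
    rw [Complex.conj_mul', Complex.norm_cpow_eq_rpow_re_of_pos hp, ← Complex.ofReal_pow,
      ← Real.rpow_natCast, ← Real.rpow_mul hp.le]
    simp
  rw [section_mul_right hG, section_mul_right hG, map_mul, mul_mul_mul_comm, h]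

variable [T2Space G] (hP : IsClosed (P : Set G)) (hKP : ∀ g : G, ∃ k ∈ K, ∃ p ∈ P, g = k * p)
  (hG : ∀ g : G, modularFunction g = 1)

-- The constant is independent of `s`, of the sections and of `φ`; this is what transfers
-- `G`-invariance of the integral over `G` to the inner product over `K`.
include hP hKP hG in
theorem exists_integral_eq_sectionInner : ∃ c : ℝ, 0 < c ∧
    ∀ (s : ℝ) (F₁ F₂ : inducedSections P (modularPower P (s : ℂ))) (φ : G → ℝ), Continuous φ →
      HasCompactSupport φ →
      (∀ x, conj (F₁.1 x) * F₂.1 x ≠ 0 → ∫ p : P, φ (x * (p : G)) ∂Measure.haar = 1) →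
      ∫ x, (φ x : ℂ) * (conj (F₁.1 x) * F₂.1 x) ∂(Measure.haar : Measure G) =
        c * sectionInner K F₁ F₂ := by
  obtain ⟨ψ, hψ, hψ0, hψK⟩ := exists_isCosetNormalized hP hKP
  obtain ⟨x₀, hx₀⟩ := Function.ne_iff.1 hψ0
  have hr := continuous_rho hP hKP
  refine ⟨∫ x, ψ x * rho K P x ∂(Measure.haar : Measure G),
    (hψ.continuous.mul hr).integral_pos_of_hasCompactSupport_nonneg_nonzero (x := x₀)
      hψ.hasCompactSupport.mul_right (fun x => mul_nonneg (hψ.nonneg x) (rho_pos hP hKP x).le)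
      (mul_ne_zero hx₀ (rho_pos hP hKP x₀).ne'), ?_⟩
  intro s F₁ F₂ φ hφ hφs hφ1
  have hc : Continuous fun x => conj (F₁.1 x) * F₂.1 x :=
    (Complex.continuous_conj.comp (continuous_section F₁)).mul (continuous_section F₂)
  rw [integral_density_eq hP hG hc (conj_section_mul_section hG F₁ F₂) hφ hφs hφ1 hψ]
  exact integral_density_eq_integral_haarProb hP hKP hc (conj_section_mul_section hG F₁ F₂) hψ hψK

include hP hKP hG in
theorem sectionInner_sectionRep {s : ℝ} (g : G)
    (F₁ F₂ : inducedSections P (modularPower P (s : ℂ))) :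
    sectionInner K (sectionRep P (modularPower P (s : ℂ)) g F₁)
      (sectionRep P (modularPower P (s : ℂ)) g F₂) = sectionInner K F₁ F₂ := by
  obtain ⟨ψ, hψ, -, -⟩ := exists_isCosetNormalized hP hKP
  obtain ⟨c, hc, h⟩ := exists_integral_eq_sectionInner hP hKP hG
  -- The translate `ψ(g ·)` is again a normalising function, and substituting `g x` for `x` turns
  -- the integral for the translated sections into this one.
  have h1 := h s F₁ F₂ (fun x => ψ (g * x)) (hψ.continuous.comp (continuous_const_mul g))
    (hψ.hasCompactSupport.comp_homeomorph (Homeomorph.mulLeft g)) fun x _ => by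
      simpa only [mul_assoc] using hψ.integral_eq_one (g * x)
  have h2 := h s (sectionRep P (modularPower P (s : ℂ)) g F₁)
    (sectionRep P (modularPower P (s : ℂ)) g F₂) ψ hψ.continuous hψ.hasCompactSupport
    fun x _ => hψ.integral_eq_one x
  rw [← integral_mul_left_eq_self _ g] at h2
  simp only [sectionRep_apply, inv_mul_cancel_left] at h2
  exact mul_left_cancel₀ (Complex.ofReal_ne_zero.2 hc.ne') (h2.symm.trans h1)

omit [T2Space G] in
theorem integrable_sectionInner {s : ℂ} (F₁ F₂ : inducedSections P (modularPower P s)) :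
    Integrable (fun k : K => conj (F₁.1 k) * F₂.1 k) (haarProb K) :=
  integrable_haarProb (((Complex.continuous_conj.comp (continuous_section F₁)).mul
    (continuous_section F₂)).comp continuous_subtype_val)

/-- The semi-inner product on sections that is given by a multiple of integration over `K`. -/
@[reducible]
noncomputable def sectionCore (K : Subgroup G) [CompactSpace K] (P : Subgroup G)
    [LocallyCompactSpace P] (s : ℂ) {c : ℝ} (hc : 0 < c) :
    PreInnerProductSpace.Core ℂ (inducedSections P (modularPower P s)) where
  inner F₁ F₂ := c * sectionInner K F₁ F₂
  conj_inner_symm F₁ F₂ := by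
    rw [map_mul, Complex.conj_ofReal, sectionInner, ← integral_conj, sectionInner]
    congr 2
    ext k
    simp [mul_comm]
  re_inner_nonneg F := by
    have : sectionInner K F F = ((∫ k : K, ‖F.1 k‖ ^ 2 ∂(haarProb K) : ℝ) : ℂ) := by
      rw [sectionInner, ← integral_complex_ofReal]
      simp only [Complex.conj_mul', Complex.ofReal_pow]
    rw [this, ← Complex.ofReal_mul]
    exact mul_nonneg hc.le (integral_nonneg fun k => sq_nonneg _)
  add_left F₁ F₂ F₃ := by
    rw [← mul_add]
    congr 1
    rw [sectionInner, sectionInner, sectionInner,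
      ← integral_add (integrable_sectionInner F₁ F₃) (integrable_sectionInner F₂ F₃)]
    refine integral_congr_ae (.of_forall fun k => ?_)
    simp [add_mul]
  smul_left F₁ F₂ r := by
    rw [mul_left_comm]
    congr 1
    rw [sectionInner, sectionInner, ← integral_const_mul]
    refine integral_congr_ae (.of_forall fun k => ?_)
    simp [mul_assoc]

include hP hKP hG in
theorem exists_isUnitarilyInduced (s : ℝ) :
    ∃ (H : Type u) (_ : NormedAddCommGroup H) (_ : InnerProductSpace ℂ H) (_ : CompleteSpace H)
      (π : G →* unitary (H →L[ℂ] H)) (J : inducedSections P (modularPower P (s : ℂ)) →ₗ[ℂ] H),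
      IsUnitarilyInduced P (modularPower P (s : ℂ)) π J := by
  obtain ⟨c, hc, h⟩ := exists_integral_eq_sectionInner hP hKP hG
  obtain ⟨H, _, _, _, π, J, h1, h2, h3, h4⟩ := exists_unitary_completion
    (sectionCore K P s hc) (sectionRep P (modularPower P (s : ℂ)))
    (fun g F₁ F₂ => congrArg (fun z : ℂ => c * z) (sectionInner_sectionRep hP hKP hG g F₁ F₂))
    (fun F => by
      have hF := continuous_section F
      refine continuous_const.mul (continuous_integral_haarProb
        (f := fun g (k : K) => conj (F.1 k) * F.1 (g⁻¹ * k)) ?_)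
      fun_prop)
  refine ⟨H, _, _, _, π, J, ?_, h1, h2, h3, ?_⟩
  · intro p
    rw [modularPower_apply, Complex.norm_cpow_eq_rpow_re_of_pos (modularFunction_pos p)]
    simp
  · intro F₁ F₂ φ hφ hφs _ hφ1
    rw [h4, h s F₁ F₂ φ hφ hφs hφ1]
    rfl

end InnerProduct

/-! ### The spherical vector of the induced representation -/

section Induced

variable {G : Type u} [Group G] [TopologicalSpace G] [IsTopologicalGroup G] [LocallyCompactSpace G]
  [MeasurableSpace G] [BorelSpace G] [T2Space G]
  {K P : Subgroup G} [CompactSpace K] [LocallyCompactSpace P]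
  (hP : IsClosed (P : Set G)) (hKP : ∀ g : G, ∃ k ∈ K, ∃ p ∈ P, g = k * p)
  (hG : ∀ g : G, modularFunction g = 1)
  {s : ℝ} {H : Type v} [NormedAddCommGroup H] [InnerProductSpace ℂ H] [CompleteSpace H]
  {π : G →* unitary (H →L[ℂ] H)} {J : inducedSections P (modularPower P (s : ℂ)) →ₗ[ℂ] H}
  (hJ : IsUnitarilyInduced P (modularPower P (s : ℂ)) π J)

-- After the swap, the integral of `F₂(k⁻¹ l)` over `k` no longer depends on `l`, so the double
-- integral factors. This is the rank-one identity on the dense subspace of sections.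
omit [T2Space G] in
theorem integral_sectionInner_sectionRep (F₁ F₂ : inducedSections P (modularPower P (s : ℂ))) :
    ∫ k : K, sectionInner K F₁ (sectionRep P (modularPower P (s : ℂ)) k F₂) ∂(haarProb K) =
      conj (∫ k : K, F₁.1 k ∂(haarProb K)) * ∫ k : K, F₂.1 k ∂(haarProb K) := by
  have h1 := continuous_section F₁
  have h2 := continuous_section F₂
  have e : ∀ l : K, ∫ k : K, F₂.1 ((k : G)⁻¹ * l) ∂(haarProb K) =
      ∫ k : K, F₂.1 k ∂(haarProb K) := by
    intro l
    have e1 := integral_inv_eq_self (fun k : K => F₂.1 ((k : G) * l)) (haarProb K)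
    have e2 := integral_mul_right_eq_self (μ := haarProb K) (fun k : K => F₂.1 k) l
    simp only [Subgroup.coe_inv] at e1
    simp only [Subgroup.coe_mul] at e2
    rw [e1, e2]
  simp only [sectionInner, sectionRep_apply]
  rw [← integral_haarProb_swap (f := fun l k : K => conj (F₁.1 l) * F₂.1 ((k : G)⁻¹ * l))
    (by fun_prop) isCompact_univ isClosed_univ (by simp)]
  simp only [integral_const_mul, e]
  rw [integral_mul_const, integral_conj]

-- The vector is `J(ϱ^{1/2+is})` divided by `√c`, where `c` relates the inner product over `G / P`
-- to that over `K`. The averaging identity extends from sections to the whole space by density and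
-- strong continuity.
include hP hKP hG hJ in
theorem exists_spherical_vector : ∃ w : H, ‖w‖ = 1 ∧ (∀ k ∈ K, (π k : H →L[ℂ] H) w = w) ∧
    (∀ u v : H, ∫ k : K, inner ℂ u ((π k : H →L[ℂ] H) v) ∂(haarProb K) =
      inner ℂ u w * inner ℂ w v) ∧
    ∀ g, phi K P s g = inner ℂ w ((π g : H →L[ℂ] H) w) := by
  obtain ⟨ψ, hψ, -, -⟩ := exists_isCosetNormalized hP hKP
  obtain ⟨c, hc, h⟩ := exists_integral_eq_sectionInner hP hKP hG
  have hin : ∀ F₁ F₂, inner ℂ (J F₁) (J F₂) = c * sectionInner K F₁ F₂ := fun F₁ F₂ => by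
    rw [hJ.inner_eq F₁ F₂ ψ hψ.continuous hψ.hasCompactSupport hψ.nonneg
      fun x _ => hψ.integral_eq_one x, h s F₁ F₂ ψ hψ.continuous hψ.hasCompactSupport
      fun x _ => hψ.integral_eq_one x]
  set F₀ := sphericalSection hP hKP hG (s : ℂ) with hF₀
  have hF₀1 : ∀ k : K, F₀.1 k = 1 := sphericalSection_coe hP hKP hG s
  have hcc : ((√c)⁻¹ : ℂ) * ((√c)⁻¹ : ℂ) * c = 1 := by
    have : ((√c : ℝ) : ℂ) * (√c : ℝ) = c := by
      rw [← Complex.ofReal_mul, Real.mul_self_sqrt hc.le]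
    have hne : ((√c : ℝ) : ℂ) ≠ 0 := Complex.ofReal_ne_zero.2 (Real.sqrt_pos.2 hc).ne'
    rw [← this]
    field_simp
  have hcoef : ∀ g, phi K P s g =
      inner ℂ (((√c)⁻¹ : ℂ) • J F₀) ((π g : H →L[ℂ] H) (((√c)⁻¹ : ℂ) • J F₀)) := by
    intro g
    rw [map_smul, ← hJ.equivariant, inner_smul_left, inner_smul_right, hin, ← mul_assoc,
      ← mul_assoc, map_inv₀, Complex.conj_ofReal, hcc, one_mul,
      phi_eq_integral_sphericalSection hP hKP hG]
    rfl
  refine ⟨((√c)⁻¹ : ℂ) • J F₀, ?_, fun k hk => ?_, ?_, hcoef⟩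
  · have h1 := hcoef 1
    rw [map_one, OneMemClass.coe_one, one_apply_eq_self, inner_self_eq_norm_sq_to_K,
      phi_eq_integral_sphericalSection hP hKP hG, map_one] at h1
    simp only [Module.End.one_apply, sphericalSection_coe, map_one, mul_one, integral_const,
      probReal_univ, one_smul] at h1
    have h2 : ‖((√c)⁻¹ : ℂ) • J F₀‖ ^ 2 = 1 := by
      rw [RCLike.ofReal_eq_complex_ofReal, ← Complex.ofReal_pow] at h1
      exact Complex.ofReal_eq_one.1 h1.symm
    exact (pow_eq_one_iff_of_nonneg (norm_nonneg _) two_ne_zero).1 h2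
  · rw [map_smul, ← hJ.equivariant, sectionRep_sphericalSection hP hKP hG s hk]
  · have hsc := hJ.strongly_continuous
    have hw1 : ∀ F, inner ℂ (((√c)⁻¹ : ℂ) • J F₀) (J F) =
        ((√c)⁻¹ : ℂ) * (c * ∫ k : K, F.1 k ∂(haarProb K)) := by
      intro F
      rw [inner_smul_left, hin, sectionInner, map_inv₀, Complex.conj_ofReal]
      simp only [hF₀1, map_one, one_mul]
    have hw2 : ∀ F, inner ℂ (J F) (((√c)⁻¹ : ℂ) • J F₀) =
        ((√c)⁻¹ : ℂ) * (c * conj (∫ k : K, F.1 k ∂(haarProb K))) := by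
      intro F
      rw [← inner_conj_symm, hw1]
      simp
    intro u v
    refine hJ.dense_range.induction_on v ?_ fun F₂ => ?_
    · refine isClosed_eq ?_ (by fun_prop)
      -- Moving `π(k)` onto the fixed vector `u` makes the integrand jointly continuous in `(k, v)`
      -- from strong continuity alone.
      have : ∀ (k : K) (v : H), inner ℂ u ((π k : H →L[ℂ] H) v) =
          inner ℂ ((π (k : G)⁻¹ : H →L[ℂ] H) u) v := by
        intro k v
        have := inner_unitary_mul_right π (k : G)⁻¹ 1 u v
        simpa using this.symm
      simp only [this]
      have h1 : Continuous fun k : K => (π (k : G)⁻¹ : H →L[ℂ] H) u :=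
        (hsc u).comp (by fun_prop)
      exact continuous_integral_haarProb
        (f := fun v (k : K) => inner ℂ ((π (k : G)⁻¹ : H →L[ℂ] H) u) v)
        ((h1.comp continuous_snd).inner continuous_fst)
    refine hJ.dense_range.induction_on u ?_ fun F₁ => ?_
    · refine isClosed_eq ?_ (by fun_prop)
      have h1 : Continuous fun k : K => (π (k : G) : H →L[ℂ] H) (J F₂) :=
        (hsc _).comp (by fun_prop)
      exact continuous_integral_haarProb
        (f := fun u (k : K) => inner ℂ u ((π (k : G) : H →L[ℂ] H) (J F₂)))
        (continuous_fst.inner (h1.comp continuous_snd))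
    · simp only [← hJ.equivariant, hin]
      rw [integral_const_mul, integral_sectionInner_sectionRep, hw1, hw2]
      linear_combination (-(c : ℂ) * conj (∫ k : K, F₁.1 k ∂(haarProb K)) *
        ∫ k : K, F₂.1 k ∂(haarProb K)) * hcc

end Induced

end GelfandSpherical

/-! ### Assembly of the theorem. -/

theorem mainTheorem5 {G : Type u} [Group G] [TopologicalSpace G] [IsTopologicalGroup G]
    [LocallyCompactSpace G] [T2Space G] [MeasurableSpace G] [BorelSpace G]
    (K : Subgroup G) [CompactSpace K] (hGK : IsGelfandPair K)
    (P : ClosedSubgroup G) (hKP : ∀ g : G, ∃ k ∈ K, ∃ p ∈ P.toSubgroup, g = k * p) :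
    -- `ϱ` is a well-defined continuous positive function
    (∀ k ∈ K, ∀ p : P.toSubgroup,
      rho K P.toSubgroup (k * (p : G)) = modularFunction p) ∧
    (∀ g : G, 0 < rho K P.toSubgroup g) ∧
    Continuous (rho K P.toSubgroup) ∧
    -- for all complex `s`: the `K`-fixed unit vector in the induced representation on continuous
    -- sections is unique up to phase, and `φ_s` is its matrix coefficient
    (∀ s : ℂ,
      (∃ F, IsFixedUnitSection K P.toSubgroup
        (modularPower P.toSubgroup s) F) ∧
      (∀ F₁ F₂, IsFixedUnitSection K P.toSubgroup
          (modularPower P.toSubgroup s) F₁ →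
        IsFixedUnitSection K P.toSubgroup
          (modularPower P.toSubgroup s) F₂ →
        ∃ c : ℂ, ‖c‖ = 1 ∧ F₂ = c • F₁) ∧
      (∀ F, IsFixedUnitSection K P.toSubgroup
          (modularPower P.toSubgroup s) F →
        ∀ g : G, phi K P.toSubgroup s g =
          ∫ k : K, starRingEnd ℂ (F.1 k) * (sectionRep P.toSubgroup
            (modularPower P.toSubgroup s) g F).1 k
              ∂(haarProb K))) ∧
    -- for all real `s`:
    ∀ s : ℝ,
      -- the unitarily induced representation exists
      (∃ (H : Type u) (_ : NormedAddCommGroup H) (_ : InnerProductSpace ℂ H) (_ : CompleteSpace H)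
        (π : G →* unitary (H →L[ℂ] H))
        (J : inducedSections P.toSubgroup
          (modularPower P.toSubgroup s) →ₗ[ℂ] H),
        IsUnitarilyInduced P.toSubgroup
          (modularPower P.toSubgroup s) π J) ∧
      -- its `K`-fixed unit vector is unique up to phase, and `φ_s` is its matrix coefficient
      (∀ (H : Type v) [NormedAddCommGroup H] [InnerProductSpace ℂ H] [CompleteSpace H]
        (π : G →* unitary (H →L[ℂ] H))
        (J : inducedSections P.toSubgroup
          (modularPower P.toSubgroup s) →ₗ[ℂ] H),
        IsUnitarilyInduced P.toSubgroup
          (modularPower P.toSubgroup s) π J →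
        (∃ w : H, IsFixedUnitVector K π w) ∧
        (∀ w₁ w₂ : H, IsFixedUnitVector K π w₁ →
          IsFixedUnitVector K π w₂ → ∃ c : ℂ, ‖c‖ = 1 ∧ w₂ = c • w₁) ∧
        (∀ w : H, IsFixedUnitVector K π w →
          ∀ g : G, phi K P.toSubgroup s g =
            inner ℂ w ((π g : H →L[ℂ] H) w))) ∧
      -- `φ_s` is a pure positive-definite spherical function
      IsSpherical K (phi K P.toSubgroup s) ∧
      IsPositiveDefinite (phi K P.toSubgroup s) ∧
      IsPure (phi K P.toSubgroup s) := by

  have hP : IsClosed (P.toSubgroup : Set G) := P.isClosed'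
  have hG : ∀ g : G, modularFunction g = 1 := hGK.modularFunction_eq_one
  refine ⟨fun k hk p => rho_mul hP hk p, rho_pos hP hKP, continuous_rho hP hKP, fun s =>
    ⟨⟨_, isFixedUnitSection_sphericalSection hP hKP hG s⟩,
      fun F₁ F₂ h₁ h₂ => h₁.exists_eq_smul hP hKP hG h₂, fun F hF g => hF.phi_eq hP hKP hG g⟩,
    fun s => ⟨exists_isUnitarilyInduced hP hKP hG s, ?_, ?_⟩⟩
  · intro H _ _ _ π J hJ
    obtain ⟨w, hw, hwK, havg, hphi⟩ := exists_spherical_vector hP hKP hG hJ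
    have key : ∀ w' : H, IsFixedUnitVector K π w' → ∃ c : ℂ, ‖c‖ = 1 ∧ w' = c • w := by
      intro w' hw'
      have h := eq_smul_of_average havg hw'.2
      refine ⟨_, ?_, h⟩
      have h1 := congrArg norm h
      rw [norm_smul, hw, mul_one, hw'.1] at h1
      exact h1.symm
    refine ⟨⟨w, hw, hwK⟩, fun w₁ w₂ h₁ h₂ => ?_, fun w' h' g => ?_⟩
    · obtain ⟨c₁, n₁, rfl⟩ := key w₁ h₁
      obtain ⟨c₂, n₂, rfl⟩ := key w₂ h₂
      have hne : c₁ ≠ 0 := fun h => by simp [h] at n₁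
      exact ⟨c₂ * c₁⁻¹, by simp [n₁, n₂], by rw [smul_smul, inv_mul_cancel_right₀ hne]⟩
    · obtain ⟨c, n, rfl⟩ := key w' h'
      rw [hphi, map_smul, inner_smul_left, inner_smul_right, ← mul_assoc, Complex.conj_mul', n]
      simp
  -- The claims on `φ_s` mention no representation, so any one realisation of the induced
  -- representation suffices.
  · obtain ⟨H, _, _, _, π, J, hJ⟩ := exists_isUnitarilyInduced hP hKP hG s
    obtain ⟨w, hw, hwK, havg, hphi⟩ := exists_spherical_vector hP hKP hG hJ
    have hc : Continuous fun g : G => inner ℂ w ((π g : H →L[ℂ] H) w) :=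
      continuous_const.inner (hJ.strongly_continuous w)
    rw [show phi K P.toSubgroup s = fun g => inner ℂ w ((π g : H →L[ℂ] H) w) from funext hphi]
    exact ⟨isSpherical_inner havg hw hc, isPositiveDefinite_inner π w,
      isPure_inner havg hw hwK hc⟩
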